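/- Let $F$ be any field, let $n\ge 1$, and let $A$ be a unital $F$-subalgebra of the algebra $M_n(F)$ of $n\times n$ matrices. For positive integers $\ell_1,\dots,\ell_t$ with $\ell_1+\dots+\ell_t=n$, let $E_{(\ell_1,\dots,\ell_t)}(F)\subseteq M_n(F)$ be the full block upper triangular matrix algebra with diagonal blocks $M_{\ell_1}(F),\dots,M_{\ell_t}(F)$, i.e. the set of all matrices whose entries below these diagonal blocks are $0$. Let $s_t=\sum_{\sigma\in S_t}\operatorname{sgn}(\sigma)\,X_{\sigma(1)}\cdots X_{\sigma(t)}$ be the standard polynomial of degree $t$ (with $s_0=1$). An $F$-algebra $R$ satisfies an element $f$ of the free associative algebra $F\{X_1,X_2,\dots\}$ if $f$ vanishes under every substitution of elements of $R$ for the variables. If $A$ does not satisfy $s_{2n-2}$, then there are positive integers $\ell_1,\dots,\ell_t$ with sum $n$ and an $F$-algebra automorphism $\tau$ of $M_n(F)$ such that $\tau(A)=E_{(\ell_1,\dots,\ell_t)}(F)$. Moreover, the following are equivalent: 1. $A$ does not satisfy $s_{2n-2}$; 2. there are positive integers $\ell_1,\dots,\ell_t$ with sum $n$ and an $F$-algebra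 automorphism $\tau$ of $M_n(F)$ such that $\tau(A)=E_{(\ell_1,\dots,\ell_t)}(F)$; 3. $A$ is isomorphic as an $F$-algebra to $E_{(\ell_1,\dots,\ell_t)}(F)$ for some positive integers $\ell_1,\dots,\ell_t$ with sum $n$; 4. $A$ satisfies no nonzero polynomial $f\in F\{X_1,X_2,\dots\}$ of (total) degree less than $2n$. -/

import Mathlib

/-- The standard polynomial `s_t = ∑_{σ ∈ S_t} sgn(σ) X_{σ(1)} ⋯ X_{σ(t)}` in the free associative
algebra over `F` in countably many variables (the variables are numbered from `0`; `s_0 = 1`). -/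
noncomputable def standardPolynomial (F : Type*) [Field F] (t : ℕ) : FreeAlgebra F ℕ :=
  ∑ σ : Equiv.Perm (Fin t),
    (Equiv.Perm.sign σ : ℤ) • (List.ofFn fun i : Fin t => FreeAlgebra.ι F ((σ i : Fin t) : ℕ)).prod

/-- `R` satisfies `f`: every substitution of elements of `R` for the variables sends `f` to `0`. -/
def SatisfiesPolynomial {F : Type*} [Field F] (R : Type*) [Ring R] [Algebra F R]
    (f : FreeAlgebra F ℕ) : Prop :=
  ∀ r : ℕ → R, FreeAlgebra.lift F r f = 0

/-- The total degree of a noncommutative polynomial: the largest length of a word that occurs in it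
with nonzero coefficient (and `0` for the zero polynomial). -/
noncomputable def noncommDegree {F : Type*} [Field F] (f : FreeAlgebra F ℕ) : ℕ :=
  (FreeAlgebra.equivMonoidAlgebraFreeMonoid f).coeff.support.sup FreeMonoid.length

/-- The full block upper triangular matrix algebra `E_{(ℓ₁,…,ℓ_t)}(F)` inside `M_n(F)`, for an
ordered sequence `c = (ℓ₁,…,ℓ_t)` of positive integers with sum `n`: the matrices whose `(i, j)`
entry vanishes whenever the block of `j` comes strictly before the block of `i`. -/
def fullBlockUpperTriangular (F : Type*) [Field F] {n : ℕ} (c : Composition n) :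
    Subalgebra F (Matrix (Fin n) (Fin n) F) :=
  Matrix.blockTriangularSubalgebra F F c.index

/-- Two subalgebras of `M_n(F)` are equivalent if some `F`-algebra automorphism of `M_n(F)` maps
the first onto the second. -/
def EquivalentSubalgebras {F : Type*} [Field F] {n : ℕ}
    (A B : Subalgebra F (Matrix (Fin n) (Fin n) F)) : Prop :=
  ∃ τ : Matrix (Fin n) (Fin n) F ≃ₐ[F] Matrix (Fin n) (Fin n) F,
    A.map (τ : Matrix (Fin n) (Fin n) F →ₐ[F] Matrix (Fin n) (Fin n) F) = B

/-!
The heart of the matter is that a subalgebra `A` of `M_n(F)` not satisfying the standard polynomial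
`s_{2n-2}` consists of all matrices that preserve some flag of `F^n`. Call an `A`-module `V` of
dimension `d` nondegenerate (`IsNondegenerate`) if `s_{2d-2}` does not vanish on it.

* Suppose that `V` is generated by `k` elements over a commutative ring `C` whose action commutes
  with that of `A`. The action of `A` lifts to `k × k` matrices over `C`, so `s_{2k}` vanishes on
  `V` by the Amitsur–Levitzki theorem (`StdVanishes.of_span`). If `δ` is an endomorphism of `V` that
  is not a scalar, some `v` and `δ v` are linearly independent, and `d - 1` elements generate `V`
  over `F[δ]`. Hence a nondegenerate module has only scalar endomorphisms
  (`IsNondegenerate.exists_eq_smul`).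
* The shuffle expansion of `s_{a+b}` as a signed sum of products `s_a s_b` shows that nonzero
  submodules and quotients of nondegenerate modules are nondegenerate. Therefore all nonzero
  subquotients have only scalar endomorphisms. Thus the submodules form a chain, as a direct sum
  has non-scalar projections (`IsNondegenerate.le_total`), and no two composition factors at
  different places are isomorphic, as an isomorphism gives a nonzero nilpotent endomorphism of a
  subquotient (`IsNondegenerate.isEmpty_linearEquiv`).
* With the Jacobson density theorem these facts imply, by induction on the dimension, that `A`
  induces every linear endomorphism that preserves all submodules
  (`IsNondegenerate.exists_smul_of_forall_mem`). In a basis adapted to the chain of submodules, `A`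
  becomes a full block upper triangular algebra.

The Amitsur–Levitzki theorem (`Matrix.stdEval_eq_zero`) is proved by Rosset's argument: a matrix
over an exterior algebra over `ℚ` with entries of degree one has a square with commuting entries,
whose positive powers have trace zero, so that the matrix is nilpotent.

Conversely, a nonzero polynomial of degree less than `2n` that holds in a block triangular algebra
can be polarized at one of its longest words (`sum_polarSubst`); evaluation at an initial part of
`e₁₁, e₁₂, e₂₂, …, eₙₙ`, whose product in any other order is zero, then gives a contradiction. The
polynomial `s_{2n-2}` is itself nonzero of degree less than `2n`, which closes the cycle of
implications.
-/

/-! ### The standard polynomial as an alternating map -/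

/-- The value `∑ σ, sgn(σ) x_{σ(1)} ⋯ x_{σ(N)}` of the standard polynomial at elements of a ring. -/
def stdEval (N : ℕ) {R : Type*} [Ring R] (x : Fin N → R) : R :=
  ∑ σ : Equiv.Perm (Fin N), (Equiv.Perm.sign σ : ℤ) • (List.ofFn fun i => x (σ i)).prod

theorem stdEval_eq_alternatization (K : Type*) [CommRing K] (N : ℕ) {R : Type*} [Ring R]
    [Algebra K R] (x : Fin N → R) :
    stdEval N x = MultilinearMap.alternatization (MultilinearMap.mkPiAlgebraFin K N R) x := by
  rw [MultilinearMap.alternatization_apply]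
  simp [stdEval, Units.smul_def]

theorem map_stdEval {N : ℕ} {R S G : Type*} [Ring R] [Ring S] [FunLike G R S] [RingHomClass G R S]
    (f : G) (x : Fin N → R) : f (stdEval N x) = stdEval N (fun i => f (x i)) := by
  simp [stdEval, map_list_prod, List.map_ofFn, Function.comp_def]

/-! ### Matrices all of whose powers have trace zero -/

namespace Matrix

variable {m E : Type*} [Fintype m] [DecidableEq m] [CommRing E]

open Polynomial in
theorem derivative_charpoly (Z : Matrix m m E) :
    derivative Z.charpoly = (charmatrix Z).adjugate.trace := by
  have hder : ∀ i j, derivative (charmatrix Z i j) = if i = j then 1 else 0 := by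
    intro i j
    by_cases h : i = j
    · subst h; simp
    · simp [h]
  have hadj : ∀ i, (charmatrix Z).adjugate i i =
      ∑ σ : Equiv.Perm m, (Equiv.Perm.sign σ : ℤ) •
        ((∏ j ∈ Finset.univ.erase i, charmatrix Z (σ j) j) * if σ i = i then 1 else 0) := by
    intro i
    rw [adjugate_def, of_apply, cramer_transpose_apply, det_apply]
    refine Finset.sum_congr rfl fun σ _ => ?_
    rw [Units.smul_def]
    congr 1
    by_cases hi : σ i = i
    · rw [← Finset.prod_erase_mul _ _ (Finset.mem_univ i), hi]
      congr 1
      · refine Finset.prod_congr rfl fun j hj => ?_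
        rw [updateRow_ne]
        exact fun h => Finset.ne_of_mem_erase hj (σ.injective (h.trans hi.symm))
      · simp
    · rw [if_neg hi, mul_zero]
      refine Finset.prod_eq_zero (Finset.mem_univ (σ.symm i)) ?_
      rw [Equiv.apply_symm_apply, updateRow_self, Pi.single_eq_of_ne]
      exact fun h => hi ((Equiv.symm_apply_eq σ).1 h).symm
  simp only [charpoly, det_apply, trace, diag_apply, hadj]
  rw [Finset.sum_comm, map_sum]
  refine Finset.sum_congr rfl fun σ _ => ?_
  rw [Units.smul_def, map_zsmul, derivative_prod_finset, Finset.smul_sum]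
  refine Finset.sum_congr rfl fun i _ => ?_
  rw [hder]

open Polynomial in
/-- Over a commutative `ℚ`-algebra, a matrix all of whose positive powers have trace zero is
nilpotent, of exponent at most its size. With `p` the characteristic polynomial, the trace of
`(X - Z) adj(X - Z) = p` reads `X p' = n p + tr(Z adj(X - Z))`; the last trace vanishes, and hence
`p = X ^ n`. -/
theorem pow_card_eq_zero_of_trace_pow_eq_zero [Algebra ℚ E] (Z : Matrix m m E)
    (h : ∀ k, (Z ^ (k + 1)).trace = 0) : Z ^ Fintype.card m = 0 := by
  set p := Z.charpoly with hp
  set B := (charmatrix Z).adjugate with hB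
  set D : Matrix m m E[X] := Z.map C with hD
  have hDpow : ∀ k, (D ^ (k + 1)).trace = 0 := by
    intro k
    have : D ^ (k + 1) = (Z ^ (k + 1)).map C := by
      rw [hD]; exact (map_pow (C : E →+* E[X]).mapMatrix Z (k + 1)).symm
    rw [this, trace]
    simp only [diag_apply, map_apply, ← map_sum]
    exact (congrArg C (h k)).trans C_0
  have hmul : (X : E[X]) • B = p • (1 : Matrix m m E[X]) + D * B := by
    have h1 : charmatrix Z * B = p • 1 := mul_adjugate _
    have h2 : charmatrix Z = (X : E[X]) • 1 - D := by
      rw [charmatrix, smul_one_eq_diagonal]; rfl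
    rw [h2, sub_mul, smul_mul_assoc, one_mul] at h1
    rw [← h1]; abel
  have hq : ∀ k, (D ^ (k + 1) * B).trace = X ^ k * (D * B).trace := by
    intro k
    induction k with
    | zero => simp
    | succ k ih =>
      have : (X : E[X]) • (D ^ (k + 1) * B) = p • D ^ (k + 1) + D ^ (k + 2) * B := by
        rw [← mul_smul_comm, hmul, mul_add, mul_smul_comm, mul_one, ← mul_assoc, ← pow_succ]
      have h2 := congrArg trace this
      rw [trace_smul, trace_add, trace_smul, hDpow, smul_zero, zero_add, ih] at h2
      rw [← h2, smul_eq_mul, pow_succ' X k, mul_assoc]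
  have hq0 : (D * B).trace = 0 := by
    have hCH : aeval D (p.map (C : E →+* E[X])) = 0 := by
      have : aeval D (p.map (C : E →+* E[X])) = (C : E →+* E[X]).mapMatrix (aeval Z p) := by
        rw [aeval_eq_sum_range, aeval_eq_sum_range, natDegree_map_eq_of_injective C_injective,
          map_sum]
        refine Finset.sum_congr rfl fun i _ => ?_
        rw [coeff_map, hD, ← RingHom.mapMatrix_apply, ← map_pow]
        ext1 a b
        simp
      rw [this, hp, aeval_self_charpoly, map_zero]
    have h0 : (D * aeval D (p.map (C : E →+* E[X])) * B).trace = 0 := by rw [hCH]; simp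
    have h1 : (D * aeval D (p.map (C : E →+* E[X])) * B).trace = p * (D * B).trace := by
      rw [aeval_eq_sum_range, Finset.mul_sum, Finset.sum_mul, trace_sum]
      have : ∀ i, (D * ((p.map C).coeff i • D ^ i) * B).trace
          = C (p.coeff i) * X ^ i * (D * B).trace := by
        intro i
        rw [mul_smul_comm, smul_mul_assoc, trace_smul, ← pow_succ', hq, coeff_map, smul_eq_mul,
          mul_assoc]
      simp_rw [this]
      rw [← Finset.sum_mul, natDegree_map_eq_of_injective (C_injective), ← as_sum_range_C_mul_X_pow]
    exact ((charpoly_monic Z).mul_right_eq_zero_iff).1 (h1.symm.trans h0)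
  have hder : X * derivative p = (Fintype.card m : E[X]) * p := by
    have := congrArg trace hmul
    rw [trace_smul, trace_add, trace_smul, trace_one, hq0, add_zero, smul_eq_mul, smul_eq_mul,
      ← derivative_charpoly] at this
    rw [this, mul_comm]
  have hcoeff : ∀ i, i ≠ Fintype.card m → p.coeff i = 0 := by
    intro i hi
    have h1 : (i : E) * p.coeff i = Fintype.card m * p.coeff i := by
      have := congrArg (fun q => coeff q i) hder
      cases i with
      | zero =>
        rw [coeff_X_mul_zero, ← C_eq_natCast, coeff_C_mul] at this
        rw [← this, Nat.cast_zero, zero_mul]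
      | succ i =>
        simp only [coeff_X_mul, coeff_derivative, ← C_eq_natCast, coeff_C_mul] at this
        rw [mul_comm, ← this]; push_cast; ring
    have h2 : ((i : ℚ) - Fintype.card m) • p.coeff i = 0 := by
      rw [sub_smul, Nat.cast_smul_eq_nsmul, Nat.cast_smul_eq_nsmul, nsmul_eq_mul, nsmul_eq_mul, h1,
        sub_self]
    exact (smul_eq_zero_iff_right (sub_ne_zero.2 (by exact_mod_cast hi))).1 h2
  have hpX : p = X ^ Fintype.card m := by
    nontriviality E
    ext i
    rw [coeff_X_pow]
    split_ifs with hi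
    · have := (charpoly_monic Z).coeff_natDegree
      rwa [charpoly_natDegree_eq_dim, ← hi] at this
    · exact hcoeff i hi
  have := aeval_self_charpoly Z
  rwa [← hp, hpX, map_pow, aeval_X] at this

end Matrix

/-! ### The Amitsur–Levitzki theorem -/

/-- Let `X` be a matrix with pairwise anticommuting entries whose square is defined over a
commutative ring `E` commuting with them. Then `tr (X ^ (2 * k)) = 0` for `k ≥ 1`, because the
entries of `X` and of `X ^ (2 * k - 1)` anticommute, and hence `X` is nilpotent. -/
theorem Matrix.pow_two_mul_card_eq_zero {m R E : Type*} [Fintype m] [DecidableEq m] [Ring R]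
    [Algebra ℚ R] [CommRing E] [Algebra ℚ E] (g : E →+* R) (hg : Function.Injective g)
    (X : Matrix m m R) (Z : Matrix m m E) (hZ : g.mapMatrix Z = X ^ 2)
    (hanti : ∀ i j i' j', X i j * X i' j' = -(X i' j' * X i j))
    (hcomm : ∀ i j z, X i j * g z = g z * X i j) : X ^ (2 * Fintype.card m) = 0 := by
  have hZk : ∀ k, g.mapMatrix (Z ^ k) = X ^ (2 * k) := by
    intro k; rw [map_pow, hZ, pow_mul]
  have htr : ∀ k, (Z ^ (k + 1)).trace = 0 := by
    intro k
    have hval : g (Z ^ (k + 1)).trace = (X ^ (2 * (k + 1))).trace := by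
      rw [← hZk]; simp [trace]
    have hodd : ∀ i j i' j', X i j * (X * X ^ (2 * k)) i' j' =
        -((X * X ^ (2 * k)) i' j' * X i j) := by
      intro i j i' j'
      rw [mul_apply, Finset.mul_sum, Finset.sum_mul, ← Finset.sum_neg_distrib]
      refine Finset.sum_congr rfl fun l _ => ?_
      have hc : X i j * (X ^ (2 * k)) l j' = (X ^ (2 * k)) l j' * X i j := by
        rw [← hZk]; exact hcomm i j _
      rw [mul_assoc, ← hc, ← mul_assoc, ← mul_assoc, hanti i j, neg_mul]
    have h1 : (X ^ (2 * (k + 1))).trace = -(X ^ (2 * (k + 1))).trace := by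
      have e1 : X ^ (2 * (k + 1)) = X * (X * X ^ (2 * k)) := by
        rw [← mul_assoc, ← sq, ← pow_add]; ring_nf
      have e2 : X ^ (2 * (k + 1)) = (X * X ^ (2 * k)) * X := by
        rw [← pow_succ', ← pow_succ]; ring_nf
      conv_lhs => rw [e1]
      rw [e2, trace, trace]
      simp only [diag_apply, mul_apply (M := X) (N := X * _), mul_apply (M := X * _) (N := X)]
      rw [Finset.sum_comm, ← Finset.sum_neg_distrib]
      refine Finset.sum_congr rfl fun i _ => ?_
      rw [← Finset.sum_neg_distrib]
      exact Finset.sum_congr rfl fun j _ => hodd _ _ _ _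
    have h2 : (2 : ℚ) • (X ^ (2 * (k + 1))).trace = 0 := by
      rw [two_smul]; nth_rewrite 1 [h1]; exact neg_add_cancel _
    apply hg
    rw [hval, map_zero]
    exact (smul_eq_zero_iff_right two_ne_zero).1 h2
  rw [← hZk, pow_card_eq_zero_of_trace_pow_eq_zero Z htr, map_zero]

section ExteriorAlgebra

variable {W : Type*} [AddCommGroup W] [Module ℚ W]

open ExteriorAlgebra in
/-- The subalgebra of the exterior algebra that is generated by products of two vectors. -/
abbrev evenSubalgebra (W : Type*) [AddCommGroup W] [Module ℚ W] :
    Subalgebra ℚ (ExteriorAlgebra ℚ W) :=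
  Algebra.adjoin ℚ (Set.range fun p : W × W => ι ℚ p.1 * ι ℚ p.2)

namespace ExteriorAlgebra

theorem ι_mul_ι_eq_neg (a b : W) : ι ℚ a * ι ℚ b = -(ι ℚ b * ι ℚ a) :=
  eq_neg_of_add_eq_zero_left (ι_add_mul_swap a b)

theorem commute_ι_mul_ι (a b c : W) : Commute (ι ℚ c) (ι ℚ a * ι ℚ b) := by
  rw [Commute, SemiconjBy, ← mul_assoc, ι_mul_ι_eq_neg c a, neg_mul, mul_assoc,
    ι_mul_ι_eq_neg c b, mul_neg, neg_neg, mul_assoc]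

theorem commute_ι_of_mem_even (c : W) {z : ExteriorAlgebra ℚ W} (hz : z ∈ evenSubalgebra W) :
    Commute (ι ℚ c) z := by
  have : evenSubalgebra W ≤ Subalgebra.centralizer ℚ {ι ℚ c} := by
    refine Algebra.adjoin_le ?_
    rintro _ ⟨⟨a, b⟩, rfl⟩
    rw [SetLike.mem_coe, Subalgebra.mem_centralizer_iff]
    rintro _ rfl
    exact commute_ι_mul_ι a b c
  exact (Subalgebra.mem_centralizer_iff ℚ).1 (this hz) _ rfl

/-- The even part of the exterior algebra is commutative. -/
noncomputable instance : CommRing (evenSubalgebra W) where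
  mul_comm := by
    have : IsMulCommutative (evenSubalgebra W) := Algebra.isMulCommutative_adjoin ℚ (by
      rintro _ ⟨⟨a, b⟩, rfl⟩ _ ⟨⟨c, d⟩, rfl⟩
      exact (commute_ι_mul_ι c d a).mul_left (commute_ι_mul_ι c d b))
    exact this.is_comm.comm

open Matrix in
/-- A matrix of vectors, read in the exterior algebra, is nilpotent. -/
theorem map_ι_pow_eq_zero {m : Type*} [Fintype m] [DecidableEq m] (x : Matrix m m W) :
    (x.map (ι ℚ)) ^ (2 * Fintype.card m) = 0 := by
  let g : evenSubalgebra W →+* ExteriorAlgebra ℚ W := (evenSubalgebra W).val.toRingHom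
  have hg : Function.Injective g := Subtype.val_injective
  refine pow_two_mul_card_eq_zero (E := evenSubalgebra W) g hg _
    (of fun i j => ∑ k, ⟨ι ℚ (x i k) * ι ℚ (x k j), Algebra.subset_adjoin ⟨(_, _), rfl⟩⟩) ?_
    (fun i j i' j' => ι_mul_ι_eq_neg _ _) (fun i j z => (commute_ι_of_mem_even (x i j) z.2).eq)
  ext i j
  simp [g, sq, mul_apply]

end ExteriorAlgebra

end ExteriorAlgebra

/-- Scalars that can be moved across the factors collect in front of a product. The scalar ring is
not assumed to be commutative. -/
theorem List.prod_ofFn_smul_eq {K R : Type*} [Ring K] [Ring R] [Module K R] [IsScalarTower K R R]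
    {N : ℕ} (c : Fin N → K) (a : Fin N → R) (h : ∀ i (z : K) (r : R), a i * z • r = z • (a i * r)) :
    (List.ofFn fun i => c i • a i).prod = (List.ofFn c).prod • (List.ofFn a).prod := by
  induction N with
  | zero => simp
  | succ N ih =>
    simp only [List.ofFn_succ, List.prod_cons]
    rw [ih _ _ fun i => h i.succ, smul_mul_assoc, h, smul_smul]

namespace Matrix

variable {m : Type*} [Fintype m] [DecidableEq m]

open ExteriorAlgebra in
/-- The standard identity for rational matrices `x k`: expand the vanishing power of
`∑ k, e k • x k`, with `e` the standard basis of `ℚ ^ N` in the exterior algebra, and compare the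
coefficients of the product of all `e k`. -/
theorem stdEval_rat_eq_zero {N : ℕ} (hN : N = 2 * Fintype.card m) (x : Fin N → Matrix m m ℚ) :
    stdEval N x = 0 := by
  let e : Fin N → (Fin N → ℚ) := Pi.basisFun ℚ (Fin N)
  let X : Matrix m m (Fin N → ℚ) := of fun i j k => x k i j
  let x' : Fin N → Matrix m m (ExteriorAlgebra ℚ (Fin N → ℚ)) :=
    fun k => (algebraMap ℚ (ExteriorAlgebra ℚ (Fin N → ℚ))).mapMatrix (x k)
  have hx' : ∀ k i j, x' k i j = algebraMap ℚ _ (x k i j) := fun _ _ _ => rfl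
  have hX : X.map (ι ℚ) = ∑ k, ι ℚ (e k) • x' k := by
    ext1 i j
    have : X i j = ∑ k, x k i j • e k := ((Pi.basisFun ℚ (Fin N)).sum_repr (X i j)).symm
    rw [map_apply, this, map_sum, sum_apply]
    refine Finset.sum_congr rfl fun k _ => ?_
    rw [map_smul, smul_apply, hx', smul_eq_mul, ← Algebra.commutes, Algebra.smul_def]
  have hcomm : ∀ k (z : ExteriorAlgebra ℚ (Fin N → ℚ)) r, x' k * z • r = z • (x' k * r) := by
    intro k z r
    ext1 i j
    simp only [mul_apply, smul_apply, smul_eq_mul, Finset.mul_sum]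
    refine Finset.sum_congr rfl fun l _ => ?_
    rw [← mul_assoc, ← mul_assoc, hx', Algebra.commutes]
  -- Expand the vanishing power and read off the coefficient of the top exterior power.
  have hpow : ∑ w : Fin N → Fin N, ιMulti ℚ N (e ∘ w) • (List.ofFn (x' ∘ w)).prod = 0 := by
    have h0 := map_ι_pow_eq_zero X
    rw [← hN, hX, ← MultilinearMap.mkPiAlgebraFin_apply_const (R := ℚ),
      MultilinearMap.map_sum] at h0
    rw [← h0]
    refine Finset.sum_congr rfl fun w _ => ?_
    rw [MultilinearMap.mkPiAlgebraFin_apply, List.prod_ofFn_smul_eq _ _ fun i => hcomm (w i),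
      ιMulti_apply]
    rfl
  -- `f` defines a linear functional on the exterior algebra that extends the determinant.
  let f : ∀ i, (Fin N → ℚ) [⋀^Fin i]→ₗ[ℚ] ℚ := fun i =>
    if h : i = N then h ▸ (Pi.basisFun ℚ (Fin N)).det else 0
  have hf : f N = (Pi.basisFun ℚ (Fin N)).det := by simp [f]
  have hdet : ∑ w : Fin N → Fin N, f N (e ∘ w) • (List.ofFn (x ∘ w)).prod = 0 := by
    ext1 i j
    have h1 := congrArg (liftAlternating (R := ℚ) f) (congrFun (congrFun hpow i) j)
    rw [sum_apply, map_sum] at h1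
    rw [zero_apply, map_zero] at h1
    rw [sum_apply, zero_apply, ← h1]
    refine Finset.sum_congr rfl fun w _ => ?_
    have h2 : (List.ofFn (x' ∘ w)).prod =
        (algebraMap ℚ (ExteriorAlgebra ℚ (Fin N → ℚ))).mapMatrix (List.ofFn (x ∘ w)).prod := by
      rw [map_list_prod, List.map_ofFn]; rfl
    rw [h2, smul_apply, smul_apply, RingHom.mapMatrix_apply, map_apply, smul_eq_mul, smul_eq_mul,
      ← Algebra.commutes, ← Algebra.smul_def, map_smul, liftAlternating_apply_ιMulti, smul_eq_mul,
      mul_comm]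
  rw [← hdet, stdEval, hf]
  symm
  rw [← Finset.sum_subset (Finset.subset_univ (Finset.univ.filter Function.Bijective))]
  · refine Finset.sum_bij (fun w hw => Equiv.ofBijective w (Finset.mem_filter.1 hw).2)
      (fun _ _ => Finset.mem_univ _) (fun w _ w' _ h => ?_) (fun σ _ => ?_) (fun w hw => ?_)
    · exact congrArg (fun σ : Equiv.Perm (Fin N) => (σ : Fin N → Fin N)) h
    · exact ⟨σ, Finset.mem_filter.2 ⟨Finset.mem_univ _, σ.bijective⟩, by ext; rfl⟩
    · have := AlternatingMap.map_perm (Pi.basisFun ℚ (Fin N)).det (Pi.basisFun ℚ (Fin N))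
        (Equiv.ofBijective w (Finset.mem_filter.1 hw).2)
      rw [Module.Basis.det_self, Units.smul_def, ← Int.cast_smul_eq_zsmul ℚ, smul_eq_mul,
        mul_one] at this
      rw [← Int.cast_smul_eq_zsmul ℚ, ← this]
      rfl
  · intro w _ hw
    rw [AlternatingMap.map_eq_zero_of_not_injective, zero_smul]
    intro h
    exact hw (by simpa using Finite.injective_iff_bijective.1 (Function.Injective.of_comp h))

/-- **Amitsur–Levitzki**: the matrices of size `n` over a commutative ring satisfy the standard
identity of degree `2 * n`. By multilinearity it is enough to treat matrix units, which are
defined over the integers. -/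
theorem stdEval_eq_zero {C : Type*} [CommRing C] (x : Fin (2 * Fintype.card m) → Matrix m m C) :
    stdEval _ x = 0 := by
  have hint : ∀ y : Fin (2 * Fintype.card m) → Matrix m m ℤ, stdEval _ y = 0 := by
    intro y
    have hinj : Function.Injective ((Int.castRingHom ℚ).mapMatrix (m := m)) :=
      map_injective (RingHom.injective_int _)
    apply hinj
    rw [map_stdEval, map_zero, stdEval_rat_eq_zero rfl]
  have h : (MultilinearMap.alternatization
      (MultilinearMap.mkPiAlgebraFin C (2 * Fintype.card m) (Matrix m m C))).toMultilinearMap =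
        0 := by
    refine Module.Basis.ext_multilinear (fun _ => stdBasis C m m) fun w => ?_
    change MultilinearMap.alternatization
      (MultilinearMap.mkPiAlgebraFin C (2 * Fintype.card m) (Matrix m m C)) _ = 0
    rw [← stdEval_eq_alternatization]
    have := congrArg (Int.castRingHom C).mapMatrix
      (hint fun i => single (w i).1 (w i).2 1)
    rw [map_stdEval, map_zero] at this
    rw [← this]
    congr 1
    funext i
    rw [stdBasis_eq_single]
    ext a b
    simp [single_apply, apply_ite (Int.cast : ℤ → C)]
  rw [stdEval_eq_alternatization C]
  exact congrArg (fun g => g x) h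

end Matrix

/-- If the standard polynomials of degrees `a` and `b` have products killed by `T`, then so does the
one of degree `a + b`, which is a signed sum of such products over all shuffles. -/
theorem stdEval_add_eq_zero {a b : ℕ} {R M : Type*} [Ring R] [AddCommGroup M] (T : R →+ M)
    (h : ∀ (y : Fin a → R) (z : Fin b → R), T (stdEval a y * stdEval b z) = 0)
    (x : Fin (a + b) → R) : T (stdEval (a + b) x) = 0 := by
  let ma := MultilinearMap.mkPiAlgebraFin ℤ a R
  let mb := MultilinearMap.mkPiAlgebraFin ℤ b R
  let Φ : TensorProduct ℤ R R →ₗ[ℤ] M := T.toIntLinearMap ∘ₗ LinearMap.mul' ℤ R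
  let e : Fin a ⊕ Fin b ≃ Fin (a + b) := finSumFinEquiv
  have h1 : T (stdEval (a + b) x) =
      Φ (MultilinearMap.alternatization (MultilinearMap.domCoprod ma mb) (x ∘ e)) := by
    rw [MultilinearMap.alternatization_apply, stdEval, map_sum, map_sum]
    refine Fintype.sum_equiv (Equiv.permCongr e.symm) _ _ fun σ => ?_
    rw [Units.smul_def, map_zsmul, map_zsmul, Equiv.Perm.sign_permCongr]
    congr 1
    have hΦ : ∀ r s, Φ (TensorProduct.tmul ℤ r s) = T (r * s) := fun _ _ => rfl
    rw [MultilinearMap.domDomCongr_apply, MultilinearMap.domCoprod_apply, hΦ,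
      MultilinearMap.mkPiAlgebraFin_apply, MultilinearMap.mkPiAlgebraFin_apply,
      ← List.prod_append, ← List.ofFn_fin_append]
    congr 3
    funext i
    refine Fin.addCases (fun i => ?_) (fun i => ?_) i <;> simp [e]
  rw [h1, MultilinearMap.domCoprod_alternization, ← AlternatingMap.coe_multilinearMap,
    AlternatingMap.domCoprod_coe, sum_apply, map_sum]
  refine Finset.sum_eq_zero fun σ _ => ?_
  induction σ using Quotient.inductionOn' with
  | h σ =>
    rw [AlternatingMap.domCoprod.summand_mk'', smul_apply, Units.smul_def, map_zsmul]
    have := h (fun i => x (e (σ (Sum.inl i)))) (fun i => x (e (σ (Sum.inr i))))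
    rw [stdEval_eq_alternatization ℤ, stdEval_eq_alternatization ℤ] at this
    refine (congrArg _ ?_).trans (smul_zero _)
    exact this

/-! ### Modules on which a standard polynomial vanishes -/

/-- The standard polynomial of degree `N` vanishes on the `A`-module `V`: all its values at elements
of `A` annihilate `V`. -/
def StdVanishes (A V : Type*) [Ring A] [AddCommGroup V] [Module A V] (N : ℕ) : Prop :=
  ∀ (x : Fin N → A) (v : V), stdEval N x • v = 0

namespace StdVanishes

variable {A V : Type*} [Ring A] [AddCommGroup V] [Module A V]

/-- The values of the standard polynomial of degree `b` map `V` into `p`, on which the one of degree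
`a` vanishes. -/
theorem add {p : Submodule A V} {a b : ℕ} (hp : StdVanishes A p a) (hq : StdVanishes A (V ⧸ p) b) :
    StdVanishes A V (a + b) := by
  intro x v
  refine stdEval_add_eq_zero ((AddMonoidHom.flip (smulAddHom A V)) v) (fun y z => ?_) x
  have hz : stdEval b z • v ∈ p := by
    rw [← Submodule.Quotient.mk_eq_zero, Submodule.Quotient.mk_smul, hq]
  have := congrArg Subtype.val (hp y ⟨_, hz⟩)
  simpa [mul_smul] using this

theorem mono {a b : ℕ} (h : StdVanishes A V a) (hab : a ≤ b) : StdVanishes A V b := by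
  obtain ⟨c, rfl⟩ := Nat.exists_eq_add_of_le hab
  intro x v
  refine stdEval_add_eq_zero ((AddMonoidHom.flip (smulAddHom A V)) v) (fun y z => ?_) x
  simpa [mul_smul] using h y _

/-- A module generated by `k` elements over a commutative ring whose action commutes with that of
`A` is annihilated by the standard polynomial of degree `2 * k`: the action of `A` lifts to
matrices of size `k`. -/
theorem of_span (C : Type*) [CommRing C] [Module C V] [SMulCommClass A C V] {k : ℕ}
    (v : Fin k → V) (hv : Submodule.span C (Set.range v) = ⊤) : StdVanishes A V (2 * k) := by
  intro x u
  choose y hy using fun i => Matrix.isRepresentation.toEnd_surjective C v hv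
    (Module.toModuleEnd C V (S := A) (x i))
  have h0 : stdEval (2 * k) y = 0 := by
    apply Subtype.val_injective
    have := Matrix.stdEval_eq_zero (m := Fin k) (C := C)
    rw [Fintype.card_fin] at this
    rw [← Subalgebra.coe_val, map_stdEval, map_zero]
    exact this _
  have h1 := congrArg (Matrix.isRepresentation.toEnd C v hv) h0
  rw [map_stdEval, map_zero] at h1
  simp_rw [hy] at h1
  rw [← map_stdEval] at h1
  exact congrArg (fun f => f u) h1

variable (F : Type*) [Field F] [Algebra F A] [Module F V] [IsScalarTower F A V]
  [FiniteDimensional F V]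

theorem two_mul_finrank : StdVanishes A V (2 * Module.finrank F V) :=
  of_span F (Module.finBasis F V) (Module.finBasis F V).span_eq

open Polynomial in
/-- A module with a non-scalar endomorphism `d` is annihilated by the standard polynomial of degree
`2 * dim V - 2`: if `v` and `d v` are linearly independent, then a hyperplane over `F` that contains
`v` but not `d v` generates `V` over `F[d]`. -/
theorem of_not_scalar (d : Module.End A V) (hd : ¬ ∃ c : F, ∀ v, d v = c • v) :
    StdVanishes A V (2 * Module.finrank F V - 2) := by
  obtain ⟨v, hv⟩ : ∃ v, d v ∉ Submodule.span F {v} := by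
    by_contra! h
    obtain ⟨c, hc⟩ := LinearMap.exists_eq_smul_id_of_forall_notLinearIndependent
      (f := d.restrictScalars F) fun v hv => by
        obtain ⟨c, hc⟩ := Submodule.mem_span_singleton.1 (h v)
        have := (LinearIndependent.pair_iff.1 hv c (-1) (by simp [hc])).2
        exact one_ne_zero (neg_eq_zero.1 this)
    exact hd ⟨c, fun v => congrArg (fun g : V →ₗ[F] V => g v) hc⟩
  obtain ⟨f, hf, hfv⟩ := Submodule.exists_le_ker_of_notMem hv
  have hfv0 : f v = 0 := hfv (Submodule.mem_span_singleton_self v)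
  have hfin : Module.finrank F (LinearMap.ker f) + 1 = Module.finrank F V :=
    Module.Dual.finrank_ker_add_one_of_ne_zero (by rintro rfl; exact hf rfl)
  let _ : Module F[X] V := Module.compHom V (aeval (R := F) d).toRingHom
  have hsmul : ∀ (p : F[X]) (u : V), p • u = aeval d p u := fun _ _ => rfl
  have hcomm : SMulCommClass A F[X] V := ⟨fun a p u => by rw [hsmul, hsmul, map_smul]⟩
  have htower : IsScalarTower F F[X] V := ⟨fun c p u => by rw [hsmul, hsmul, map_smul]; rfl⟩
  let b := Module.finBasis F (LinearMap.ker f)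
  have hker : LinearMap.ker f ≤
      (Submodule.span F[X] (Set.range fun i => (b i : V))).restrictScalars F := by
    intro u hu
    have : _ = u := congrArg Subtype.val (b.sum_repr ⟨u, hu⟩)
    rw [← this, AddSubmonoidClass.coe_finsetSum]
    exact Submodule.sum_mem _ fun i _ => Submodule.smul_mem _ _ (Submodule.subset_span ⟨i, rfl⟩)
  have := of_span (A := A) F[X] (fun i => (b i : V)) (by
    rw [eq_top_iff]
    intro u _
    have hdv : d v ∈ Submodule.span F[X] (Set.range fun i => (b i : V)) := by
      have : d v = (X : F[X]) • v := by rw [hsmul, aeval_X]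
      rw [this]
      exact Submodule.smul_mem _ _ (hker hfv0)
    have h1 : u - (f u / f (d v)) • d v ∈ LinearMap.ker f := by
      rw [LinearMap.mem_ker, map_sub, map_smul, smul_eq_mul, div_mul_cancel₀ _ hf, sub_self]
    have h2 := Submodule.add_mem _ (hker h1)
      (Submodule.smul_mem (Submodule.restrictScalars F _) (f u / f (d v)) hdv)
    simpa using h2)
  convert this using 1
  omega

end StdVanishes

/-! ### Nondegenerate modules -/

section Tower

variable {F A V : Type*} [Field F] [Ring A] [Algebra F A] [AddCommGroup V] [Module F V]
  [Module A V] [IsScalarTower F A V]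

instance Submodule.finiteDimensional_of_tower [FiniteDimensional F V] (p : Submodule A V) :
    FiniteDimensional F p :=
  inferInstanceAs (FiniteDimensional F (p.restrictScalars F))

theorem Submodule.finrank_quotient_add_finrank_of_tower [FiniteDimensional F V]
    (p : Submodule A V) :
    Module.finrank F (V ⧸ p) + Module.finrank F p = Module.finrank F V :=
  (p.restrictScalars F).finrank_quotient_add_finrank

end Tower

/-- An `A`-module `V` of dimension `n` over `F` is nondegenerate if it is not annihilated by the
standard polynomial of degree `2 * n - 2`. -/
def IsNondegenerate (F A V : Type*) [Field F] [Ring A] [AddCommGroup V] [Module F V] [Module A V] :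
    Prop :=
  ¬ StdVanishes A V (2 * Module.finrank F V - 2)

namespace IsNondegenerate

variable {F A V : Type*} [Field F] [Ring A] [Algebra F A] [AddCommGroup V] [Module F V]
  [Module A V] [IsScalarTower F A V] [FiniteDimensional F V]

omit [Algebra F A] [IsScalarTower F A V] [FiniteDimensional F V] in
theorem nontrivial (h : IsNondegenerate F A V) : Nontrivial V := by
  by_contra hV
  rw [not_nontrivial_iff_subsingleton] at hV
  exact h fun _ _ => Subsingleton.elim _ _

theorem submodule (h : IsNondegenerate F A V) {p : Submodule A V} (hp : p ≠ ⊥) :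
    IsNondegenerate F A p := by
  intro hs
  have := p.finrank_quotient_add_finrank_of_tower (F := F)
  have hpos : 0 < Module.finrank F p := by
    have := (Submodule.nontrivial_iff_ne_bot).2 hp
    exact Module.finrank_pos
  exact h ((hs.add (StdVanishes.two_mul_finrank F)).mono (by omega))

theorem quotient (h : IsNondegenerate F A V) {p : Submodule A V} (hp : p ≠ ⊤) :
    IsNondegenerate F A (V ⧸ p) := by
  intro hs
  have := p.finrank_quotient_add_finrank_of_tower (F := F)
  have hpos : 0 < Module.finrank F (V ⧸ p) := by
    have := Submodule.Quotient.nontrivial_iff.2 hp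
    exact Module.finrank_pos
  exact h (((StdVanishes.two_mul_finrank F).add hs).mono (by omega))

/-- **Schur's lemma** for nondegenerate modules, with scalars from the base field. -/
theorem exists_eq_smul (h : IsNondegenerate F A V) (d : Module.End A V) :
    ∃ c : F, ∀ v, d v = c • v := by
  by_contra hd
  exact h (StdVanishes.of_not_scalar F d hd)

/-- A nondegenerate module contains no direct sum of two nonzero submodules. -/
theorem eq_bot_or_eq_bot_of_disjoint (h : IsNondegenerate F A V) {p q : Submodule A V}
    (hpq : Disjoint p q) : p = ⊥ ∨ q = ⊥ := by
  by_contra! hne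
  obtain ⟨x, hx, hx0⟩ := Submodule.exists_mem_ne_zero_of_ne_bot hne.1
  obtain ⟨y, hy, hy0⟩ := Submodule.exists_mem_ne_zero_of_ne_bot hne.2
  let f : (p × q) →ₗ[A] V := p.subtype.coprod q.subtype
  have hf : Function.Injective f := by
    rw [← LinearMap.ker_eq_bot, LinearMap.ker_coprod_of_disjoint_range]
    · simp
    · simpa using hpq
  let e := LinearEquiv.ofInjective f hf
  have hr : LinearMap.range f ≠ ⊥ := by
    intro h0
    exact hx0 (by simpa [f] using LinearMap.congr_fun (LinearMap.range_eq_bot.1 h0) (⟨x, hx⟩, 0))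
  -- The projection of `p ⊔ q` onto `p` is an endomorphism that is not a scalar.
  obtain ⟨c, hc⟩ := (h.submodule hr).exists_eq_smul
    (e.toLinearMap ∘ₗ LinearMap.inl A p q ∘ₗ LinearMap.fst A p q ∘ₗ e.symm.toLinearMap)
  have h1 := congrArg Subtype.val (hc (e (⟨x, hx⟩, 0)))
  have h2 := congrArg Subtype.val (hc (e (0, ⟨y, hy⟩)))
  simp only [LinearMap.comp_apply, LinearEquiv.coe_coe, LinearEquiv.symm_apply_apply] at h1 h2
  simp [e, f] at h1 h2
  rcases smul_eq_zero.1 h2.symm with rfl | h2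
  · exact hx0 (by simpa using h1)
  · exact hy0 h2

/-- The submodules of a nondegenerate module form a chain. -/
theorem le_total (h : IsNondegenerate F A V) (p q : Submodule A V) : p ≤ q ∨ q ≤ p := by
  by_contra! hpq
  have htop : p ⊓ q ≠ ⊤ := by
    intro ht
    exact hpq.1 ((inf_eq_top_iff.1 ht).2 ▸ le_top)
  have hd : Disjoint (p.map (p ⊓ q).mkQ) (q.map (p ⊓ q).mkQ) := by
    rw [Submodule.disjoint_def]
    rintro _ ⟨x, hx, rfl⟩ ⟨y, hy, hxy⟩
    rw [Submodule.mkQ_apply, Submodule.Quotient.mk_eq_zero]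
    refine ⟨hx, ?_⟩
    have : y - x ∈ p ⊓ q := (Submodule.Quotient.eq _).1 hxy
    simpa using q.sub_mem hy this.2
  rcases (h.quotient htop).eq_bot_or_eq_bot_of_disjoint hd with h0 | h0
  · rw [← le_bot_iff, Submodule.map_le_iff_le_comap, Submodule.comap_bot, Submodule.ker_mkQ] at h0
    exact hpq.1 (h0.trans inf_le_right)
  · rw [← le_bot_iff, Submodule.map_le_iff_le_comap, Submodule.comap_bot, Submodule.ker_mkQ] at h0
    exact hpq.2 (h0.trans inf_le_left)

/-- A nonzero submodule is not isomorphic to the quotient by a submodule that contains it: otherwise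
`V → V ⧸ q ≃ p → V` would be a nonzero nilpotent endomorphism. -/
theorem isEmpty_linearEquiv (h : IsNondegenerate F A V) {p q : Submodule A V} (hp : p ≠ ⊥)
    (hpq : p ≤ q) : IsEmpty ((V ⧸ q) ≃ₗ[A] p) := by
  refine ⟨fun e => ?_⟩
  obtain ⟨x, hx, hx0⟩ := Submodule.exists_mem_ne_zero_of_ne_bot hp
  obtain ⟨c, hc⟩ := h.exists_eq_smul (p.subtype ∘ₗ e.toLinearMap ∘ₗ q.mkQ)
  have h1 := hc x
  have hx1 : q.mkQ x = 0 := (Submodule.Quotient.mk_eq_zero q).2 (hpq hx)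
  simp only [LinearMap.comp_apply, hx1, map_zero] at h1
  have hc0 : c = 0 := (smul_eq_zero.1 h1.symm).resolve_right hx0
  obtain ⟨v, hv⟩ := q.mkQ_surjective (e.symm ⟨x, hx⟩)
  have h2 := hc v
  simp [hv, hc0] at h2
  exact hx0 h2

end IsNondegenerate

/-! ### Idempotents from the density theorem -/

section Density

variable {F A : Type*} [Field F] [Ring A] [Algebra F A]

/-- If `S` and `T` are non-isomorphic simple modules of finite dimension, then some element of `A`
acts as `0` on `S` and as `1` on `T`. -/
theorem exists_smul_eq_zero_and_smul_eq_self {S T : Type*} [AddCommGroup S] [Module F S]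
    [Module A S] [IsScalarTower F A S] [FiniteDimensional F S] [AddCommGroup T] [Module F T]
    [Module A T] [IsScalarTower F A T] [FiniteDimensional F T] [IsSimpleModule A S]
    [IsSimpleModule A T] (h : IsEmpty (S ≃ₗ[A] T)) :
    ∃ e : A, (∀ s : S, e • s = 0) ∧ ∀ t : T, e • t = t := by
  classical
  have hST : ∀ g : S →ₗ[A] T, g = 0 := fun g =>
    (LinearMap.bijective_or_eq_zero g).resolve_left fun hg =>
      h.false (LinearEquiv.ofBijective g hg)
  have hTS : ∀ g : T →ₗ[A] S, g = 0 := fun g =>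
    (LinearMap.bijective_or_eq_zero g).resolve_left fun hg =>
      h.false (LinearEquiv.ofBijective g hg).symm
  -- The projection onto `T` commutes with all endomorphisms of `S × T`.
  let π : Module.End (Module.End A (S × T)) (S × T) :=
    { toFun := fun x => (0, x.2)
      map_add' := fun x y => by simp
      map_smul' := fun g x => by
        have h1 : (g (x.1, 0)).2 = 0 := LinearMap.congr_fun
          (hST (LinearMap.snd A S T ∘ₗ g ∘ₗ LinearMap.inl A S T)) x.1
        have h2 : (g (0, x.2)).1 = 0 := LinearMap.congr_fun
          (hTS (LinearMap.fst A S T ∘ₗ g ∘ₗ LinearMap.inr A S T)) x.2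
        have h3 : g x = g (x.1, 0) + g (0, x.2) := by rw [← map_add]; simp
        simp only [Module.End.smul_def, RingHom.id_apply]
        ext
        · simp [h2]
        · simp [h3, h1] }
  have hss : IsSemisimpleModule A (S × T) := by
    have h := IsSemisimpleModule.sup (IsSemisimpleModule.range (LinearMap.inl A S T))
      (IsSemisimpleModule.range (LinearMap.inr A S T))
    rw [LinearMap.sup_range_inl_inr] at h
    exact IsSemisimpleModule.congr Submodule.topEquiv.symm
  let b := Module.finBasis F (S × T)
  obtain ⟨e, he⟩ := jacobson_density (R := A) π (Finset.univ.image b)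
  have hall : ∀ x : S × T, e • x = (0, x.2) := by
    intro x
    have : (Module.toModuleEnd F (S × T) (S := A) e) =
        LinearMap.inr F S T ∘ₗ LinearMap.snd F S T := by
      refine b.ext fun i => ?_
      exact (he (b i) (by simp)).symm
    exact LinearMap.congr_fun this x
  exact ⟨e, fun s => congrArg Prod.fst (hall (s, 0)), fun t => congrArg Prod.snd (hall (0, t))⟩

variable {V : Type*} [AddCommGroup V] [Module F V] [Module A V] [IsScalarTower F A V]
  [FiniteDimensional F V]

/-- On a nondegenerate module some element of `A` acts as a projection onto a given simple
submodule, since no other composition factor is isomorphic to that submodule. -/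
theorem IsNondegenerate.exists_projection (h : IsNondegenerate F A V) (p : Submodule A V)
    [IsSimpleModule A p] : ∃ e : A, (∀ v, e • v ∈ p) ∧ ∀ v ∈ p, e • v = v := by
  have hp : p ≠ ⊥ := (isSimpleModule_iff_isAtom.1 ‹_›).1
  suffices H : ∀ (n : ℕ) (q : Submodule A V), p ≤ q → Module.finrank F q = n →
      ∃ e : A, (∀ v ∈ q, e • v ∈ p) ∧ ∀ v ∈ p, e • v = v by
    obtain ⟨e, he⟩ := H _ ⊤ le_top rfl
    exact ⟨e, fun v => he.1 v trivial, he.2⟩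
  intro n
  induction n using Nat.strong_induction_on with
  | _ n ih =>
    intro q hpq hq
    rcases hpq.eq_or_lt with rfl | hlt
    · exact ⟨1, by simp, by simp⟩
    have hNoeth : IsNoetherian A V := isNoetherian_of_tower F inferInstance
    obtain ⟨r, hpr, hrq⟩ := exists_le_covBy_of_lt hlt
    have hr : Module.finrank F r < n := by
      rw [← hq]
      exact Submodule.finrank_lt_finrank_of_lt
        (s := r.restrictScalars F) (t := q.restrictScalars F) hrq.lt
    obtain ⟨e, he, he'⟩ := ih _ hr r hpr rfl
    have hsimple := (covBy_iff_quot_is_simple hrq.le).1 hrq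
    have hqn : IsNondegenerate F A q := h.submodule (ne_bot_of_le_ne_bot hp hpq)
    have hemp : IsEmpty ((q ⧸ Submodule.comap q.subtype r) ≃ₗ[A] p) := by
      refine ⟨fun g => ?_⟩
      have hp' : Submodule.comap q.subtype p ≠ ⊥ := by
        obtain ⟨x, hx, hx0⟩ := Submodule.exists_mem_ne_zero_of_ne_bot hp
        intro h0
        have : (⟨x, hpq hx⟩ : q) ∈ Submodule.comap q.subtype p := hx
        rw [h0, Submodule.mem_bot] at this
        exact hx0 (congrArg Subtype.val this)
      exact (hqn.isEmpty_linearEquiv hp' (Submodule.comap_mono hpr)).false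
        (g.trans (Submodule.comapSubtypeEquivOfLe hpq).symm)
    obtain ⟨e₂, h₂, h₂'⟩ := exists_smul_eq_zero_and_smul_eq_self (F := F) hemp
    refine ⟨e * e₂, fun v hv => ?_, fun v hv => ?_⟩
    · rw [mul_smul]
      refine he _ ?_
      have := h₂ (Submodule.Quotient.mk ⟨v, hv⟩)
      rw [← Submodule.Quotient.mk_smul, Submodule.Quotient.mk_eq_zero] at this
      exact this
    · have : e₂ • v = v := congrArg Subtype.val (h₂' ⟨v, hv⟩)
      rw [mul_smul, this, he' v hv]

end Density

/-! ### Nondegenerate modules are reflexive -/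

namespace IsNondegenerate

universe u v w

variable {F : Type u} {A : Type v} [Field F] [Ring A] [Algebra F A]

section

variable {V : Type w} [AddCommGroup V] [Module F V] [Module A V] [IsScalarTower F A V]
  [FiniteDimensional F V]

/-- Let `p` be a simple submodule and `e` a projection onto `p`, and let `r ≠ ⊥` be a submodule of
`V ⧸ p`. Some element of the form `e * a * (1 - e)` does not kill the preimage of `r`: otherwise the
kernel of `e` would meet that preimage in a complement of `p`. -/
theorem exists_mul_smul_ne_zero (h : IsNondegenerate F A V) {p : Submodule A V} (hp : p ≠ ⊥) {e : A}
    (he : ∀ v, e • v ∈ p) (he' : ∀ v ∈ p, e • v = v) {r : Submodule A (V ⧸ p)} (hr : r ≠ ⊥) :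
    ∃ (a : A) (v : V), p.mkQ v ∈ r ∧ (e * a * (1 - e)) • v ≠ 0 := by
  by_contra! H
  let U : Submodule A V :=
    { carrier := {v | p.mkQ v ∈ r ∧ e • v = 0}
      add_mem' := fun {x y} hx hy => ⟨by rw [map_add]; exact r.add_mem hx.1 hy.1, by
        rw [smul_add, hx.2, hy.2, add_zero]⟩
      zero_mem' := ⟨by simp, by simp⟩
      smul_mem' := fun a x hx => ⟨by rw [map_smul]; exact r.smul_mem a hx.1, by
        have := H a x hx.1
        rwa [mul_smul, sub_smul, one_smul, hx.2, sub_zero, mul_smul] at this⟩ }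
  have hd : Disjoint p U := by
    rw [Submodule.disjoint_def]
    intro x hx hxU
    rw [← he' x hx]
    exact hxU.2
  rcases h.eq_bot_or_eq_bot_of_disjoint hd with h0 | h0
  · exact hp h0
  · obtain ⟨w, hw, hw0⟩ := Submodule.exists_mem_ne_zero_of_ne_bot hr
    obtain ⟨v, rfl⟩ := p.mkQ_surjective w
    have hev : p.mkQ (e • v) = 0 := (Submodule.Quotient.mk_eq_zero p).2 (he v)
    have hmem : v - e • v ∈ U := by
      refine ⟨?_, ?_⟩
      · rw [map_sub, hev, sub_zero]; exact hw
      · rw [smul_sub, he' _ (he v), sub_self]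
    rw [h0, Submodule.mem_bot, sub_eq_zero] at hmem
    exact hw0 (by rw [hmem, hev])

/-- Let `p` be a simple submodule such that `A` induces all endomorphisms of `V ⧸ p` that preserve
its submodules. Then every linear map `V → p` that kills `p` is induced by `A`: it is a sum of maps
of rank one, and these factor as `V ⧸ p → r → p` for a minimal submodule `r` of `V ⧸ p`. -/
theorem exists_smul_of_range_le (h : IsNondegenerate F A V) {p : Submodule A V}
    [IsSimpleModule A p] (htop : p ≠ ⊤)
    (hq : ∀ φ : (V ⧸ p) →ₗ[F] (V ⧸ p), (∀ r : Submodule A (V ⧸ p), ∀ v ∈ r, φ v ∈ r) →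
      ∃ a : A, ∀ v, φ v = a • v)
    (ψ : V →ₗ[F] V) (hψ : ∀ v, ψ v ∈ p) (hψ' : ∀ v ∈ p, ψ v = 0) :
    ∃ a : A, ∀ v, ψ v = a • v := by
  have hp : p ≠ ⊥ := (isSimpleModule_iff_isAtom.1 ‹_›).1
  have hqn : IsNondegenerate F A (V ⧸ p) := h.quotient htop
  have := hqn.nontrivial
  have hart : IsArtinian A (V ⧸ p) := isArtinian_of_tower F inferInstance
  obtain ⟨r, hr⟩ := IsAtomic.exists_atom (Submodule A (V ⧸ p))
  obtain ⟨e, he, he'⟩ := h.exists_projection p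
  obtain ⟨a₀, v₂, hv₂, hne⟩ := h.exists_mul_smul_ne_zero hp he he' hr.1
  set a₁ := e * a₀ * (1 - e) with ha₁
  have ha₁p : ∀ v ∈ p, a₁ • v = 0 := by
    intro v hv
    rw [ha₁, mul_smul, sub_smul, one_smul, he' v hv, sub_self, smul_zero]
  have hy : a₁ • v₂ ∈ p := by
    rw [ha₁, mul_assoc, mul_smul]; exact he _
  obtain ⟨s, hs⟩ := (p.mkQ.restrictScalars F).exists_rightInverse_of_surjective
    (LinearMap.range_eq_top.2 p.mkQ_surjective)
  have hs' : ∀ w, p.mkQ (s w) = w := fun w => LinearMap.congr_fun hs w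
  -- Linear functionals `f` on `V ⧸ p` give the maps `w ↦ f w • v₂`, which preserve all submodules.
  have hrank : ∀ f : (V ⧸ p) →ₗ[F] F, ∃ a : A, ∀ w, f w • p.mkQ v₂ = a • w := by
    intro f
    refine hq (f.smulRight (p.mkQ v₂)) fun q w hw => ?_
    rw [LinearMap.smulRight_apply]
    by_cases hq0 : q = ⊥
    · rw [hq0, Submodule.mem_bot] at hw
      rw [hw, map_zero, zero_smul]
      exact q.zero_mem
    · have hrq : r ≤ q := by
        rcases hqn.le_total r q with h1 | h1
        · exact h1
        · rcases hr.le_iff.1 h1 with h2 | h2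
          · exact absurd h2 hq0
          · exact h2.ge
      exact (q.restrictScalars F).smul_mem _ (hrq hv₂)
  have hb : ∀ x ∈ p, ∃ b : A, b • a₁ • v₂ = x := by
    intro x hx
    have hspan := (IsSimpleOrder.eq_bot_or_eq_top
      (Submodule.span A {(⟨a₁ • v₂, hy⟩ : p)})).resolve_left (by
        rw [Submodule.span_singleton_eq_bot]
        exact fun h0 => hne (congrArg Subtype.val h0))
    obtain ⟨b, hb⟩ := Submodule.mem_span_singleton.1 (hspan.ge (Submodule.mem_top (x := ⟨x, hx⟩)))
    exact ⟨b, congrArg Subtype.val hb⟩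
  let B := Module.finBasis F p
  let ψ' : V →ₗ[F] p := LinearMap.codRestrict (p.restrictScalars F) ψ hψ
  choose a ha using fun i => hrank (B.coord i ∘ₗ ψ' ∘ₗ s)
  choose b hb using fun i => hb (B i) (B i).2
  refine ⟨∑ i, b i * (a₁ * a i), fun v => ?_⟩
  rw [Finset.sum_smul]
  have h1 : ψ v = ∑ i, B.coord i (ψ' v) • (B i : V) := by
    have := congrArg Subtype.val (B.sum_repr (ψ' v))
    rw [AddSubmonoidClass.coe_finsetSum] at this
    exact this.symm
  rw [h1]
  refine Finset.sum_congr rfl fun i _ => ?_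
  have h2 : ψ' (s (p.mkQ v)) = ψ' v := by
    rw [← sub_eq_zero, ← map_sub]
    refine Subtype.ext (hψ' _ ?_)
    rw [← Submodule.Quotient.mk_eq_zero, ← Submodule.mkQ_apply, map_sub, hs', sub_self]
  have h3 : B.coord i (ψ' v) • v₂ - a i • v ∈ p := by
    rw [← Submodule.Quotient.mk_eq_zero, ← Submodule.mkQ_apply, map_sub,
      LinearMap.map_smul_of_tower, LinearMap.map_smul p.mkQ (a i) v, sub_eq_zero, ← ha i (p.mkQ v)]
    change _ = B.coord i (ψ' (s (p.mkQ v))) • _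
    rw [h2]
  have h4 := ha₁p _ h3
  rw [smul_sub, sub_eq_zero, smul_comm] at h4
  rw [mul_smul, mul_smul, ← h4, smul_comm, hb]

end

/-- The algebra `A` induces every linear endomorphism of a nondegenerate module that preserves all
submodules. -/
theorem exists_smul_of_forall_mem : ∀ (n : ℕ) (V : Type w) [AddCommGroup V] [Module F V]
    [Module A V] [IsScalarTower F A V] [FiniteDimensional F V], Module.finrank F V = n →
    IsNondegenerate F A V → ∀ φ : V →ₗ[F] V, (∀ q : Submodule A V, ∀ v ∈ q, φ v ∈ q) →
    ∃ a : A, ∀ v, φ v = a • v := by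
  intro n
  induction n using Nat.strong_induction_on with
  | _ n ih =>
  intro V _ _ _ _ _ hn h φ hφ
  have := h.nontrivial
  have hart : IsArtinian A V := isArtinian_of_tower F inferInstance
  obtain ⟨p, hpa⟩ := IsAtomic.exists_atom (Submodule A V)
  have hsimple : IsSimpleModule A p := isSimpleModule_iff_isAtom.2 hpa
  -- By the density theorem and Schur's lemma, `φ` is induced on `p`.
  have hsub : ∃ b : A, ∀ v ∈ p, φ v = b • v := by
    classical
    let φp : Module.End (Module.End A p) p :=
      { toFun := fun v => ⟨φ v, hφ p v v.2⟩
        map_add' := fun v w => Subtype.ext (by simp)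
        map_smul' := fun d v => by
          obtain ⟨c, hc⟩ := (h.submodule hpa.1).exists_eq_smul d
          rw [RingHom.id_apply, Module.End.smul_def, Module.End.smul_def, hc, hc]
          exact Subtype.ext (φ.map_smul c v) }
    let B := Module.finBasis F p
    obtain ⟨b, hb⟩ := jacobson_density (R := A) φp (Finset.univ.image B)
    have hall : φ ∘ₗ (p.restrictScalars F).subtype =
        (p.restrictScalars F).subtype ∘ₗ (Module.toModuleEnd F p (S := A) b) :=
      B.ext fun i => congrArg Subtype.val (hb (B i) (by simp))
    exact ⟨b, fun v hv => LinearMap.congr_fun hall (⟨v, hv⟩ : p)⟩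
  obtain ⟨b, hb⟩ := hsub
  by_cases htop : p = ⊤
  · exact ⟨b, fun v => hb v (htop ▸ trivial)⟩
  have hq : ∀ φ : (V ⧸ p) →ₗ[F] (V ⧸ p), (∀ r : Submodule A (V ⧸ p), ∀ v ∈ r, φ v ∈ r) →
      ∃ a : A, ∀ v, φ v = a • v := by
    have h1 := p.finrank_quotient_add_finrank_of_tower (F := F)
    have h2 : 0 < Module.finrank F p := by
      have := (Submodule.nontrivial_iff_ne_bot).2 hpa.1
      exact Module.finrank_pos
    exact ih _ (by omega) (V ⧸ p) rfl (h.quotient htop)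
  obtain ⟨s, hs⟩ := (p.mkQ.restrictScalars F).exists_rightInverse_of_surjective
    (LinearMap.range_eq_top.2 p.mkQ_surjective)
  have hs' : ∀ w, p.mkQ (s w) = w := fun w => LinearMap.congr_fun hs w
  have hφs : ∀ v, p.mkQ (φ (s (p.mkQ v))) = p.mkQ (φ v) := by
    intro v
    rw [← sub_eq_zero, ← map_sub, ← map_sub, Submodule.mkQ_apply, Submodule.Quotient.mk_eq_zero]
    refine hφ p _ ?_
    rw [← Submodule.Quotient.mk_eq_zero, ← Submodule.mkQ_apply, map_sub, hs', sub_self]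
  obtain ⟨a, ha⟩ := hq (p.mkQ.restrictScalars F ∘ₗ φ ∘ₗ s) fun r w hw => by
    have := hφ (r.comap p.mkQ) (s w) (by rw [Submodule.mem_comap, hs']; exact hw)
    exact this
  have ha' : ∀ v, φ v - a • v ∈ p := by
    intro v
    rw [← Submodule.Quotient.mk_eq_zero, ← Submodule.mkQ_apply, map_sub, map_smul, ← hφs,
      sub_eq_zero]
    exact ha _
  obtain ⟨e, he, he'⟩ := h.exists_projection p
  -- The element `e * b + (1 - e) * a` induces `φ` on both `p` and `V ⧸ p`.
  obtain ⟨c, hc⟩ := h.exists_smul_of_range_le htop hq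
    (φ - Module.toModuleEnd F V (S := A) (e * b + (1 - e) * a)) (fun v => by
      have : φ v - (e * b + (1 - e) * a) • v = (φ v - a • v) - e • (b • v - a • v) := by
        simp only [add_smul, mul_smul, sub_smul, one_smul, smul_sub]; abel
      change φ v - (e * b + (1 - e) * a) • v ∈ p
      rw [this]
      exact p.sub_mem (ha' v) (he _)) (fun v hv => by
      change φ v - (e * b + (1 - e) * a) • v = 0
      rw [add_smul, mul_smul, mul_smul, sub_smul, one_smul, he' _ (p.smul_mem b hv),
        he' _ (p.smul_mem a hv), sub_self, add_zero, hb v hv, sub_self])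
  refine ⟨c + (e * b + (1 - e) * a), fun v => ?_⟩
  rw [add_smul, ← hc]
  exact (sub_add_cancel (φ v) ((e * b + (1 - e) * a) • v)).symm

end IsNondegenerate

/-! ### Bases adapted to a chain of subspaces -/

/-- An increasing sequence of subspaces has an adapted independent set, constructed by extending a
basis step by step. -/
theorem exists_linearIndepOn_adapted {K V : Type*} [DivisionRing K] [AddCommGroup V] [Module K V]
    (W : ℕ → Submodule K V) (hW : Monotone W) (k : ℕ) :
    ∃ s : Set V, s ⊆ W k ∧ LinearIndepOn K id s ∧
      ∀ j ≤ k, W j ≤ Submodule.span K (s ∩ W j) := by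
  have step : ∀ (k : ℕ) (s : Set V), s ⊆ W k → LinearIndepOn K id s →
      ∃ b, s ⊆ b ∧ b ⊆ (W k : Set V) ∧ LinearIndepOn K id b ∧
        W k ≤ Submodule.span K (b ∩ W k) := by
    intro k s hs hli
    obtain ⟨b, hb, hsb, hspan, hbli⟩ := exists_linearIndepOn_id_extension hli hs
    exact ⟨b, hsb, hb, hbli, by rwa [Set.inter_eq_left.2 hb]⟩
  induction k with
  | zero =>
    obtain ⟨b, -, hb, hli, hspan⟩ := step 0 ∅ (Set.empty_subset _) (linearIndepOn_empty _ _)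
    exact ⟨b, hb, hli, fun j hj => by rwa [Nat.le_zero.1 hj]⟩
  | succ k ih =>
    obtain ⟨s, hs, hli, hspan⟩ := ih
    obtain ⟨b, hsb, hb, hbli, hbspan⟩ := step (k + 1) s (hs.trans (hW k.le_succ)) hli
    refine ⟨b, hb, hbli, fun j hj => ?_⟩
    rcases Nat.le_succ_iff.1 hj with hj | rfl
    · exact (hspan j hj).trans (Submodule.span_mono (Set.inter_subset_inter_left _ hsb))
    · exact hbspan

/-- If the submodules of a finite-dimensional `A`-module form a chain, then there is a basis, graded
by a monotone function `g`, for which the endomorphisms that preserve all submodules are the ones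
with a block upper triangular matrix. -/
theorem exists_basis_blockTriangular {F A V : Type*} [Field F] [Ring A] [Algebra F A]
    [AddCommGroup V] [Module F V] [Module A V] [IsScalarTower F A V] [FiniteDimensional F V] {n : ℕ}
    (hn : Module.finrank F V = n) (htot : ∀ p q : Submodule A V, p ≤ q ∨ q ≤ p) :
    ∃ (b : Module.Basis (Fin n) F V) (g : Fin n → ℕ), Monotone g ∧ ∀ φ : V →ₗ[F] V,
      (∀ q : Submodule A V, ∀ v ∈ q, φ v ∈ q) ↔ (LinearMap.toMatrix b b φ).BlockTriangular g := by
  classical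
  -- Grade a vector by the dimension of the submodule that it generates.
  let D : V → ℕ := fun v => Module.finrank F (Submodule.span A {v})
  have hle : ∀ p q : Submodule A V, Module.finrank F p ≤ Module.finrank F q → p ≤ q := by
    intro p q h
    rcases htot p q with h1 | h1
    · exact h1
    · have := Submodule.eq_of_le_of_finrank_le (S₁ := q.restrictScalars F)
        (S₂ := p.restrictScalars F) h1 h
      exact (Submodule.restrictScalars_injective F A V this).ge
  have hmem : ∀ (q : Submodule A V) v, v ∈ q ↔ D v ≤ Module.finrank F q := by
    intro q v
    rw [← Submodule.span_singleton_le_iff_mem]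
    exact ⟨fun h => Submodule.finrank_mono (s := (Submodule.span A {v}).restrictScalars F)
      (t := q.restrictScalars F) h, hle _ _⟩
  have hD0 : D 0 = 0 := Nat.le_zero.1 (((hmem ⊥ 0).1 (zero_mem _)).trans
    (finrank_bot F V).le)
  have hgen : ∀ v w, D v ≤ D w → v ∈ Submodule.span A {w} := fun v w h => (hmem _ v).2 h
  let W : ℕ → Submodule A V := fun k =>
    { carrier := {v | D v ≤ k}
      zero_mem' := by simp [hD0]
      add_mem' := fun {v w} hv hw => by
        rcases le_total (D v) (D w) with h | h
        · exact ((hmem _ _).1 (Submodule.add_mem _ (hgen v w h)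
            (Submodule.mem_span_singleton_self w))).trans hw
        · exact ((hmem _ _).1 (Submodule.add_mem _ (Submodule.mem_span_singleton_self v)
            (hgen w v h))).trans hv
      smul_mem' := fun a v hv =>
        ((hmem _ _).1 (Submodule.smul_mem _ a (Submodule.mem_span_singleton_self v))).trans hv }
  have hWtop : W n = ⊤ := by
    rw [eq_top_iff]
    intro v _
    exact ((Submodule.span A {v}).restrictScalars F).finrank_le.trans hn.le
  obtain ⟨s, -, hli, hspan⟩ := exists_linearIndepOn_adapted
    (fun k => (W k).restrictScalars F) (fun i j hij v hv => le_trans hv hij) n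
  have hs : ⊤ ≤ Submodule.span F (Set.range ((↑) : s → V)) := by
    have := hspan n le_rfl
    rw [hWtop, Submodule.restrictScalars_top] at this
    refine this.trans (Submodule.span_mono ?_)
    rw [Subtype.range_coe]
    exact Set.inter_subset_left
  let b₀ : Module.Basis s F V := Module.Basis.mk hli hs
  have hfin : Fintype s := FiniteDimensional.fintypeBasisIndex b₀
  let e₀ : s ≃ Fin n := Fintype.equivFinOfCardEq
    ((Module.finrank_eq_card_basis b₀).symm.trans hn)
  let g₀ : Fin n → ℕ := fun i => D (b₀ (e₀.symm i))
  let e : s ≃ Fin n := e₀.trans (Tuple.sort g₀).symm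
  let b := b₀.reindex e
  have hb : ∀ i, b i = b₀ (e₀.symm (Tuple.sort g₀ i)) := fun i => by simp [b, e]
  refine ⟨b, fun i => D (b i), ?_, fun φ => ?_⟩
  · have := Tuple.monotone_sort g₀
    intro i j hij
    change D (b i) ≤ D (b j)
    rw [hb, hb]
    exact this hij
  -- Each `W k` is spanned by the basis vectors that it contains.
  have hrepr : ∀ k ≤ n, ∀ v ∈ W k, ∀ i, k < D (b i) → b.repr v i = 0 := by
    intro k hk v hv i hi
    have hker : (W k).restrictScalars F ≤ LinearMap.ker (b.coord i) := by
      refine (hspan k hk).trans (Submodule.span_le.2 ?_)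
      rintro x ⟨hx, hxk⟩
      have hxb : x = b (e ⟨x, hx⟩) := by simp [b, b₀]
      rw [SetLike.mem_coe, LinearMap.mem_ker, Module.Basis.coord_apply, hxb,
        Module.Basis.repr_self, Finsupp.single_eq_of_ne]
      rintro rfl
      rw [← hxb] at hi
      exact absurd hi (not_lt.2 hxk)
    exact hker hv
  have hDn : ∀ v, D v ≤ n := fun v => (hWtop.ge trivial : v ∈ W n)
  constructor
  · intro h i j hij
    rw [LinearMap.toMatrix_apply]
    exact hrepr (D (b j)) (hDn _) _ (h (W (D (b j))) (b j) (le_refl (D (b j)))) i hij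
  · intro h q v hv
    rw [← b.sum_repr v, map_sum]
    refine Submodule.sum_mem _ fun j _ => ?_
    rw [map_smul]
    by_cases hj : b.repr v j = 0
    · rw [hj, zero_smul]; exact q.zero_mem
    refine (q.restrictScalars F).smul_mem _ ?_
    have hjq : b j ∈ q := by
      rw [hmem]
      by_contra hlt
      exact hj (hrepr (Module.finrank F q)
        ((q.restrictScalars F).finrank_le.trans hn.le) v ((hmem q v).1 hv) j (not_le.1 hlt))
    rw [← b.sum_repr (φ (b j))]
    refine Submodule.sum_mem _ fun i _ => ?_
    by_cases hij : D (b j) < D (b i)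
    · have := h hij
      rw [LinearMap.toMatrix_apply] at this
      rw [this, zero_smul]
      exact q.zero_mem
    · exact (q.restrictScalars F).smul_mem _
        ((hmem q _).2 ((not_lt.1 hij).trans ((hmem q _).1 hjq)))

/-! ### Compositions from monotone functions -/

/-- The blocks on which a monotone function on `Fin n` is constant form a composition of `n`. -/
theorem exists_composition_index_lt_iff {n : ℕ} (g : Fin n → ℕ) (hg : Monotone g) :
    ∃ c : Composition n, ∀ i j, c.index j < c.index i ↔ g j < g i := by
  classical
  -- The boundaries are the positions preceded by an increase of `g`.
  let S : CompositionAsSet n :=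
    { boundaries := Finset.univ.filter fun k => k = 0 ∨ k = Fin.last n ∨
        ∃ i j : Fin n, (i : ℕ) + 1 = k ∧ (j : ℕ) = k ∧ g i < g j
      zero_mem := by simp
      getLast_mem := by simp }
  have hS : S.toComposition.boundaries = S.boundaries := S.toComposition_boundaries
  refine ⟨S.toComposition, fun i j => ?_⟩
  set c := S.toComposition with hc
  constructor
  · intro h
    have hk : c.boundary (c.index j).succ ∈ c.boundaries := by
      simp [Composition.boundaries]
    rw [hS] at hk
    have h1 : (j : ℕ) < c.sizeUpTo (c.index j + 1) := c.lt_sizeUpTo_index_succ j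
    have h2 : c.sizeUpTo (c.index j + 1) ≤ i :=
      (c.monotone_sizeUpTo (Nat.succ_le_of_lt h)).trans (c.sizeUpTo_index_le i)
    have hval : (c.boundary (c.index j).succ : ℕ) = c.sizeUpTo (c.index j + 1) := rfl
    simp only [S, Finset.mem_filter, Finset.mem_univ, true_and] at hk
    rcases hk with hk | hk | ⟨i', j', hi', hj', hlt⟩
    · have := congrArg Fin.val hk
      rw [hval, Fin.val_zero] at this
      omega
    · have := congrArg Fin.val hk
      rw [hval, Fin.val_last] at this
      have := i.2
      omega
    · rw [hval] at hi' hj'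
      have hji : j ≤ i' := by rw [Fin.le_def]; omega
      have hij : j' ≤ i := by rw [Fin.le_def]; omega
      exact (hg hji).trans_lt (hlt.trans_le (hg hij))
  · intro h
    by_contra hle
    rw [not_lt] at hle
    -- The first position at which `g` exceeds `g j` is a boundary between `j` and `i`.
    have hex : ∃ k, ∃ hk : k < n, g j < g ⟨k, hk⟩ := ⟨i, i.2, h⟩
    obtain ⟨hk, hgk⟩ := Nat.find_spec hex
    set k := Nat.find hex with hkdef
    have hjk : (j : ℕ) < k := by
      by_contra hkj
      exact absurd (hg (show (⟨k, hk⟩ : Fin n) ≤ j from not_lt.1 hkj)) (not_le.2 hgk)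
    have hki : k ≤ i := Nat.find_min' hex ⟨i.2, h⟩
    have hmem : (⟨k, by omega⟩ : Fin (n + 1)) ∈ S.boundaries := by
      simp only [S, Finset.mem_filter, Finset.mem_univ, true_and]
      refine Or.inr (Or.inr ⟨⟨k - 1, by omega⟩, ⟨k, hk⟩, ?_, rfl, lt_of_le_of_lt ?_ hgk⟩)
      · simp only; omega
      · by_contra hlt
        exact Nat.find_min hex (show k - 1 < k by omega) ⟨by omega, not_le.1 hlt⟩
    rw [← hS] at hmem
    simp only [Composition.boundaries, Finset.mem_map, Finset.mem_univ, true_and] at hmem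
    obtain ⟨l, hl⟩ := hmem
    have hl' : c.sizeUpTo l = k := congrArg Fin.val hl
    have h1 := c.sizeUpTo_index_le j
    have h2 : (i : ℕ) < c.sizeUpTo (c.index i + 1) := c.lt_sizeUpTo_index_succ i
    have hl1 : (c.index j : ℕ) < l := by
      by_contra hcon
      have := c.monotone_sizeUpTo (not_lt.1 hcon)
      omega
    have h3 : (c.index i : ℕ) ≤ c.index j := hle
    have := c.monotone_sizeUpTo (show (c.index i : ℕ) + 1 ≤ l by omega)
    omega

/-! ### Polarization at a word of top degree -/

section Polarization

variable {F R : Type*} [Field F] [Ring R] [Algebra F R]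

theorem lift_eq_sum_coeff (r : ℕ → R) (f : FreeAlgebra F ℕ) :
    FreeAlgebra.lift F r f = ∑ v ∈ (FreeAlgebra.equivMonoidAlgebraFreeMonoid f).coeff.support,
      (FreeAlgebra.equivMonoidAlgebraFreeMonoid f).coeff v •
        ((FreeMonoid.toList v).map r).prod := by
  have h : FreeAlgebra.lift F r = (MonoidAlgebra.lift F R (FreeMonoid ℕ) (FreeMonoid.lift r)).comp
      (FreeAlgebra.equivMonoidAlgebraFreeMonoid (R := F) (X := ℕ)).toAlgHom := by
    ext i
    simp [FreeAlgebra.equivMonoidAlgebraFreeMonoid]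
  rw [h]
  change MonoidAlgebra.lift F R (FreeMonoid ℕ) (FreeMonoid.lift r)
    (FreeAlgebra.equivMonoidAlgebraFreeMonoid f) = _
  rw [MonoidAlgebra.lift_apply]
  simp only [Finsupp.sum, FreeMonoid.lift_apply]

/-- Toggling an element outside the range of `κ` pairs off the sets that contain that range. -/
theorem sum_neg_one_pow_card_mul_prod_eq_zero {m d : ℕ} (κ : Fin m → Fin d)
    (hκ : ¬ Function.Surjective κ) :
    ∑ T : Finset (Fin d), (-1 : F) ^ T.card * ∏ j, (if κ j ∈ T then 1 else 0) = 0 := by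
  classical
  obtain ⟨k, hk⟩ := not_forall.1 hκ
  have hk' : ∀ j, κ j ≠ k := fun j h => hk ⟨j, h⟩
  refine Finset.sum_involution (fun T _ => if k ∈ T then T.erase k else insert k T)
    (fun T _ => ?_) (fun T _ _ => ?_) (fun _ _ => Finset.mem_univ _) (fun T _ => ?_)
  · by_cases hT : k ∈ T
    · have hcard : T.card = (T.erase k).card + 1 := (Finset.card_erase_add_one hT).symm
      simp only [hT, if_true, Finset.mem_erase, ne_eq, hk', not_false_eq_true, true_and]
      rw [hcard, pow_succ]; ring
    · simp only [hT, if_false, Finset.mem_insert, hk', false_or]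
      rw [Finset.card_insert_of_notMem hT, pow_succ]; ring
  · by_cases hT : k ∈ T
    · simp only [hT, if_true]
      exact fun h => Finset.erase_eq_self.1 h hT
    · simp only [hT, if_false]
      exact fun h => hT (Finset.insert_eq_self.1 h)
  · by_cases hT : k ∈ T
    · simp [hT, Finset.insert_erase hT]
    · simp [hT, Finset.erase_insert hT]

theorem Fin.coe_eq_of_strictMono {m d : ℕ} (h : m = d) {κ : Fin m → Fin d} (hκ : StrictMono κ)
    (j : Fin m) : (κ j : ℕ) = j := by
  subst h
  have : κ = id := (StrictMono.range_inj hκ strictMono_id).1 (by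
    rw [(Finite.injective_iff_surjective.1 hκ.injective).range_eq, Set.range_id])
  rw [this]; rfl

/-- The substitution that sends the variable `i` to the sum of the elements `y k` over those
positions `k ∈ T` at which the word `w` has the letter `i`. -/
noncomputable def polarSubst (F : Type*) {R : Type*} [Field F] [Ring R] [Algebra F R] (w : List ℕ)
    (y : Fin w.length → R) (T : Finset (Fin w.length)) (i : ℕ) : R :=
  ∑ k, (if k ∈ T then (1 : F) else 0) • (if w.get k = i then y k else 0)

/-- Inclusion–exclusion over the sets of positions of `w`: the alternating sum of the values of a
word `v` that is not longer than `w` only keeps the terms in which every `y k` occurs, hence occurs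
exactly once. If increasing products of the `y k` are the only nonzero ones, these terms cancel
unless `v = w`. -/
theorem sum_polarSubst (w : List ℕ) (y : Fin w.length → R)
    (hy : ∀ (m : ℕ) (κ : Fin m → Fin w.length), Function.Injective κ →
      (List.ofFn fun j => y (κ j)).prod ≠ 0 → StrictMono κ)
    (v : List ℕ) (hv : v.length ≤ w.length) :
    ∑ T : Finset (Fin w.length), (-1 : F) ^ T.card • (v.map (polarSubst F w y T)).prod =
      if v = w then (-1 : F) ^ w.length • (List.ofFn y).prod else 0 := by
  classical
  let u : Fin v.length → Fin w.length → R := fun j k => if w.get k = v.get j then y k else 0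
  let χ : (Fin v.length → Fin w.length) → F := fun κ =>
    ∑ T : Finset (Fin w.length), (-1 : F) ^ T.card * ∏ j, (if κ j ∈ T then 1 else 0)
  have hexp : ∀ T, (v.map (polarSubst F w y T)).prod = ∑ κ : Fin v.length → Fin w.length,
      (∏ j, (if κ j ∈ T then (1 : F) else 0)) • (List.ofFn fun j => u j (κ j)).prod := by
    intro T
    have h1 : v.map (polarSubst F w y T) =
        List.ofFn fun j => ∑ k, (if k ∈ T then (1 : F) else 0) • u j k := by
      conv_lhs => rw [← List.ofFn_get v, List.map_ofFn]
      rfl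
    rw [h1, ← MultilinearMap.mkPiAlgebraFin_apply (R := F), MultilinearMap.map_sum]
    refine Finset.sum_congr rfl fun κ _ => ?_
    rw [MultilinearMap.map_smul_univ _ (fun j => if κ j ∈ T then (1 : F) else 0),
      MultilinearMap.mkPiAlgebraFin_apply]
  have hsum : ∑ T : Finset (Fin w.length), (-1 : F) ^ T.card • (v.map (polarSubst F w y T)).prod =
      ∑ κ : Fin v.length → Fin w.length, χ κ • (List.ofFn fun j => u j (κ j)).prod := by
    simp_rw [hexp, Finset.smul_sum, smul_smul]
    rw [Finset.sum_comm]
    simp_rw [← Finset.sum_smul]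
    rfl
  have hterm : ∀ κ, χ κ • (List.ofFn fun j => u j (κ j)).prod ≠ 0 →
      v.length = w.length ∧ ∀ j, (κ j : ℕ) = j ∧ w.get (κ j) = v.get j := by
    intro κ hκ
    have hsurj : Function.Surjective κ := by
      by_contra h
      exact hκ (by rw [show χ κ = 0 from sum_neg_one_pow_card_mul_prod_eq_zero κ h, zero_smul])
    have hlen : v.length = w.length :=
      le_antisymm hv (by simpa using Fintype.card_le_of_surjective κ hsurj)
    have hprod : (List.ofFn fun j => u j (κ j)).prod ≠ 0 := right_ne_zero_of_smul hκ
    have hcond : ∀ j, w.get (κ j) = v.get j := by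
      intro j
      by_contra h
      refine hprod (List.prod_eq_zero ?_)
      rw [List.mem_ofFn]
      exact ⟨j, if_neg h⟩
    have hinj : Function.Injective κ :=
      ((Fintype.bijective_iff_surjective_and_card κ).2 ⟨hsurj, by simpa using hlen⟩).1
    have hu : (fun j => u j (κ j)) = fun j => y (κ j) := funext fun j => if_pos (hcond j)
    rw [hu] at hprod
    exact ⟨hlen, fun j => ⟨Fin.coe_eq_of_strictMono hlen (hy _ κ hinj hprod) j, hcond j⟩⟩
  rw [hsum]
  split_ifs with hvw
  · subst hvw
    rw [Finset.sum_eq_single id]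
    · have hχ : χ id = (-1 : F) ^ v.length := by
        simp only [χ]
        rw [Finset.sum_eq_single Finset.univ]
        · simp
        · intro T _ hT
          obtain ⟨k, hk⟩ : ∃ k, k ∉ T := by
            by_contra! h
            exact hT (Finset.eq_univ_iff_forall.2 h)
          rw [Finset.prod_eq_zero (Finset.mem_univ k) (if_neg hk), mul_zero]
        · exact fun h => absurd (Finset.mem_univ _) h
      rw [hχ]
      congr 3
      funext j
      exact if_pos rfl
    · intro κ _ hκ
      by_contra h
      exact hκ (funext fun j => Fin.ext ((hterm κ h).2 j).1)
    · exact fun h => absurd (Finset.mem_univ _) h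
  · refine Finset.sum_eq_zero fun κ _ => ?_
    by_contra h
    obtain ⟨hlen, hj⟩ := hterm κ h
    refine hvw (List.ext_get hlen fun j h1 h2 => ?_)
    rw [← (hj ⟨j, h1⟩).2]
    congr 1
    exact Fin.ext (hj ⟨j, h1⟩).1

/-- If `R` contains arbitrary sequences, up to the degree of `f`, whose product is nonzero while all
rearranged products vanish, then `R` does not satisfy `f`. -/
theorem not_satisfiesPolynomial_of_exists {f : FreeAlgebra F ℕ} (hf : f ≠ 0)
    (h : ∃ y : Fin (noncommDegree f) → R, (List.ofFn y).prod ≠ 0 ∧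
      ∀ (m : ℕ) (κ : Fin m → Fin (noncommDegree f)), Function.Injective κ →
        (List.ofFn fun j => y (κ j)).prod ≠ 0 → StrictMono κ) :
    ¬ SatisfiesPolynomial R f := by
  intro hs
  set p := (FreeAlgebra.equivMonoidAlgebraFreeMonoid f).coeff with hp
  have hsupp : p.support.Nonempty := by
    rw [Finsupp.support_nonempty_iff]
    intro h0
    refine hf (FreeAlgebra.equivMonoidAlgebraFreeMonoid.injective ?_)
    rw [map_zero]
    exact MonoidAlgebra.coeff_injective h0
  obtain ⟨w, hw, hwd⟩ := Finset.exists_mem_eq_sup p.support hsupp FreeMonoid.length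
  have hd : noncommDegree f = (FreeMonoid.toList w).length := hwd
  rw [hd] at h
  obtain ⟨y, hy0, hy⟩ := h
  have hlen : ∀ v ∈ p.support, (FreeMonoid.toList v).length ≤ (FreeMonoid.toList w).length :=
    fun v hv => hd ▸ Finset.le_sup (f := FreeMonoid.length) hv
  have h0 : ∑ T : Finset (Fin (FreeMonoid.toList w).length), (-1 : F) ^ T.card •
      FreeAlgebra.lift F (polarSubst F (FreeMonoid.toList w) y T) f = 0 :=
    Finset.sum_eq_zero fun T _ => by rw [hs, smul_zero]
  simp_rw [lift_eq_sum_coeff, ← hp, Finset.smul_sum] at h0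
  rw [Finset.sum_comm] at h0
  simp_rw [smul_comm _ (p _), ← Finset.smul_sum] at h0
  rw [Finset.sum_congr rfl fun v hv => by rw [sum_polarSubst _ y hy _ (hlen v hv)],
    Finset.sum_eq_single w] at h0
  · rw [if_pos rfl, smul_smul] at h0
    refine hy0 ((smul_eq_zero.1 h0).resolve_left (mul_ne_zero (Finsupp.mem_support_iff.1 hw) ?_))
    exact pow_ne_zero _ (neg_ne_zero.2 one_ne_zero)
  · intro v _ hv
    rw [if_neg fun h => hv (FreeMonoid.toList.injective h), smul_zero]
  · exact fun h => absurd hw h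

end Polarization

/-! ### Block triangular algebras satisfy no polynomial of small degree -/

theorem List.isChain_mul_ne_zero {M : Type*} [MonoidWithZero M] {l : List M} (h : l.prod ≠ 0) :
    l.IsChain fun a b => a * b ≠ 0 := by
  induction l with
  | nil => exact List.IsChain.nil
  | cons a l ih =>
    rw [List.prod_cons] at h
    cases l with
    | nil => exact List.IsChain.singleton a
    | cons b l =>
      rw [List.isChain_cons_cons]
      refine ⟨fun h0 => h ?_, ih (right_ne_zero_of_mul h)⟩
      rw [List.prod_cons, ← mul_assoc, h0, zero_mul]

section Staircase

variable (F : Type*) [Field F]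

/-- An initial part of the staircase `e₁₁, e₁₂, e₂₂, e₂₃, …` has a matrix unit as its product (the
identity matrix, if it is empty). -/
theorem prod_staircase {n : ℕ} (hn : 0 < n) (d : ℕ) (hd : d < 2 * n) :
    (List.ofFn fun k : Fin d => (Matrix.single (⟨k / 2, by omega⟩ : Fin n)
      (⟨(k + 1) / 2, by omega⟩ : Fin n) (1 : F))).prod ≠ 0 := by
  have key : ∀ (d : ℕ) (hd : d + 1 < 2 * n), (List.ofFn fun k : Fin (d + 1) =>
      (Matrix.single (⟨k / 2, by omega⟩ : Fin n) (⟨(k + 1) / 2, by omega⟩ : Fin n) (1 : F))).prod =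
      Matrix.single ⟨0, hn⟩ ⟨(d + 1) / 2, by omega⟩ 1 := by
    intro d hd
    induction d with
    | zero => simp
    | succ d ih =>
      rw [List.ofFn_succ', List.concat_eq_append, List.prod_append, List.prod_singleton]
      simp only [Fin.val_castSucc, Fin.val_last]
      rw [ih (by omega), Matrix.single_mul_single_same, mul_one]
  cases d with
  | zero =>
    have : Nonempty (Fin n) := ⟨⟨0, hn⟩⟩
    simp
  | succ d =>
    rw [key d hd]
    intro h
    have := congrFun (congrFun h ⟨0, hn⟩) ⟨(d + 1) / 2, by omega⟩
    simp at this

/-- Consecutive matrix units with nonzero product have weakly increasing positions in the staircase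
`e₁₁, e₁₂, e₂₂, …`; without repetitions, the increase is strict. -/
theorem strictMono_of_prod_staircase_ne_zero {n d m : ℕ} (hd : d < 2 * n) (κ : Fin m → Fin d)
    (hκ : Function.Injective κ)
    (h : (List.ofFn fun j => Matrix.single (⟨κ j / 2, by omega⟩ : Fin n)
      (⟨(κ j + 1) / 2, by omega⟩ : Fin n) (1 : F)).prod ≠ 0) : StrictMono κ := by
  have hchain := List.isChain_ofFn.1 (List.isChain_mul_ne_zero h)
  cases m with
  | zero => exact fun i => i.elim0
  | succ m =>
    rw [Fin.strictMono_iff_lt_succ]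
    intro i
    have h1 := hchain i (by omega)
    have h2 : ((κ i.castSucc : ℕ) + 1) / 2 = (κ i.succ : ℕ) / 2 := by
      by_contra hne
      exact h1 (Matrix.single_mul_single_of_ne _ _ _ _ (fun h => hne (congrArg Fin.val h)) _)
    have h3 : κ i.castSucc ≠ κ i.succ := fun h => (Fin.castSucc_lt_succ (i := i)).ne (hκ h)
    rw [Fin.lt_def]
    have h4 : (κ i.castSucc : ℕ) ≠ κ i.succ := fun h => h3 (Fin.ext h)
    omega

theorem Composition.index_mono {n : ℕ} (c : Composition n) : Monotone c.index := by
  intro i j hij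
  by_contra h
  rw [not_le] at h
  have h1 := c.lt_sizeUpTo_index_succ j
  have h2 := (c.monotone_sizeUpTo (Nat.succ_le_of_lt h)).trans (c.sizeUpTo_index_le i)
  exact absurd (h1.trans_le h2) (not_lt.2 hij)

variable {F}

/-- The matrix units `e₁₁, e₁₂, e₂₂, e₂₃, …, eₙₙ` witness that a block upper triangular matrix
algebra satisfies no nonzero polynomial of degree less than `2 * n`. -/
theorem not_satisfiesPolynomial_fullBlockUpperTriangular {n : ℕ} (hn : 0 < n) (c : Composition n)
    {f : FreeAlgebra F ℕ} (hf : f ≠ 0) (hd : noncommDegree f < 2 * n) :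
    ¬ SatisfiesPolynomial (fullBlockUpperTriangular F c) f := by
  let y : Fin (noncommDegree f) → fullBlockUpperTriangular F c := fun k =>
    ⟨Matrix.single ⟨k / 2, by omega⟩ ⟨(k + 1) / 2, by omega⟩ 1, by
      intro i j hij
      rw [Matrix.single_apply_of_ne]
      rintro ⟨rfl, rfl⟩
      refine absurd hij (not_lt.2 (c.index_mono ?_))
      rw [Fin.le_def]
      simp only
      omega⟩
  have hval : ∀ {m : ℕ} (x : Fin m → fullBlockUpperTriangular F c),
      ((List.ofFn x).prod : Matrix (Fin n) (Fin n) F) = (List.ofFn fun j => (x j).1).prod := by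
    intro m x
    rw [← Subalgebra.coe_val, map_list_prod, List.map_ofFn]
    rfl
  refine not_satisfiesPolynomial_of_exists hf ⟨y, fun h => ?_, fun m κ hκ h => ?_⟩
  · refine prod_staircase F hn _ hd ?_
    have := congrArg Subtype.val h
    rwa [hval] at this
  · refine strictMono_of_prod_staircase_ne_zero F hd κ hκ fun h0 => h ?_
    apply Subtype.val_injective
    rw [hval]
    exact h0

end Staircase

/-! ### The standard polynomial in the free algebra -/

section StandardPolynomial

variable {F : Type*} [Field F]

theorem lift_standardPolynomial {R : Type*} [Ring R] [Algebra F R] (r : ℕ → R) (t : ℕ) :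
    FreeAlgebra.lift F r (standardPolynomial F t) = stdEval t fun i => r i := by
  simp [standardPolynomial, stdEval, map_list_prod, List.map_ofFn, Function.comp_def]

theorem coeff_standardPolynomial (t : ℕ) :
    (FreeAlgebra.equivMonoidAlgebraFreeMonoid (standardPolynomial F t)).coeff =
      ∑ σ : Equiv.Perm (Fin t), (Equiv.Perm.sign σ : ℤ) •
        Finsupp.single (FreeMonoid.ofList (List.ofFn fun i => ((σ i : Fin t) : ℕ))) (1 : F) := by
  have hprod : ∀ l : List ℕ, (l.map fun i => MonoidAlgebra.single (FreeMonoid.of i) (1 : F)).prod =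
      MonoidAlgebra.single (FreeMonoid.ofList l) 1 := by
    intro l
    induction l with
    | nil => rfl
    | cons i l ih =>
      rw [List.map_cons, List.prod_cons, ih, MonoidAlgebra.single_mul_single, mul_one]
      rfl
  rw [standardPolynomial, map_sum, MonoidAlgebra.coeff_sum]
  refine Finset.sum_congr rfl fun σ _ => ?_
  rw [map_zsmul, map_list_prod, List.map_ofFn, MonoidAlgebra.coeff_smul,
    ← MonoidAlgebra.coeff_single, ← hprod, List.map_ofFn]
  congr 4
  funext i
  simp [FreeAlgebra.equivMonoidAlgebraFreeMonoid]

theorem standardPolynomial_ne_zero (t : ℕ) : standardPolynomial F t ≠ 0 := by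
  classical
  intro h
  have h1 := coeff_standardPolynomial (F := F) t
  rw [h, map_zero] at h1
  have h2 := DFunLike.congr_fun h1 (FreeMonoid.ofList (List.ofFn fun i : Fin t => (i : ℕ)))
  rw [Finsupp.finsetSum_apply, Finset.sum_eq_single 1] at h2
  · simp at h2
  · intro σ _ hσ
    rw [Finsupp.smul_apply, Finsupp.single_eq_of_ne, smul_zero]
    intro h3
    refine hσ (Equiv.ext fun i => Fin.ext ?_)
    exact (congrFun (List.ofFn_injective (FreeMonoid.ofList.injective h3)) i).symm
  · exact fun h => absurd (Finset.mem_univ _) h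

theorem noncommDegree_standardPolynomial_le (t : ℕ) :
    noncommDegree (standardPolynomial F t) ≤ t := by
  classical
  refine Finset.sup_le fun w hw => ?_
  rw [coeff_standardPolynomial] at hw
  obtain ⟨σ, -, hσ⟩ := Finset.mem_biUnion.1 (Finsupp.support_finsetSum hw)
  have := Finsupp.support_single_subset (Finsupp.support_smul hσ)
  rw [Finset.mem_singleton.1 this]
  exact (List.length_ofFn).le

end StandardPolynomial

theorem SatisfiesPolynomial.of_algEquiv {F R S : Type*} [Field F] [Ring R] [Ring S] [Algebra F R]
    [Algebra F S] (e : R ≃ₐ[F] S) {f : FreeAlgebra F ℕ} (h : SatisfiesPolynomial R f) :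
    SatisfiesPolynomial S f := by
  intro r
  have h1 : FreeAlgebra.lift F r = e.toAlgHom.comp (FreeAlgebra.lift F fun i => e.symm (r i)) := by
    ext i; simp
  rw [h1, AlgHom.comp_apply, h, map_zero]

/-! ### Subalgebras of matrix algebras -/

theorem EquivalentSubalgebras.nonempty_algEquiv {F : Type*} [Field F] {n : ℕ}
    {A B : Subalgebra F (Matrix (Fin n) (Fin n) F)} (h : EquivalentSubalgebras A B) :
    Nonempty (A ≃ₐ[F] B) := by
  obtain ⟨τ, hτ⟩ := h
  exact ⟨(A.equivMapOfInjective (τ : Matrix (Fin n) (Fin n) F →ₐ[F] Matrix (Fin n) (Fin n) F)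
    τ.injective).trans (Subalgebra.equivOfEq _ _ hτ)⟩

/-- A subalgebra of the matrix algebra that does not satisfy the standard identity of degree
`2 * n - 2` acts nondegenerately on the column vectors; hence it consists of all matrices that
preserve a flag, and a basis adapted to that flag makes it block upper triangular. -/
theorem exists_equivalentSubalgebras {F : Type*} [Field F] {n : ℕ}
    (A : Subalgebra F (Matrix (Fin n) (Fin n) F))
    (h : ¬ SatisfiesPolynomial A (standardPolynomial F (2 * n - 2))) :
    ∃ c : Composition n, EquivalentSubalgebras A (fullBlockUpperTriangular F c) := by
  have hsmul : ∀ (a : A) (v : Fin n → F), a • v = Matrix.toLin' a.1 v := fun _ _ => rfl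
  have hfin : Module.finrank F (Fin n → F) = n := by simp
  have hnd : IsNondegenerate F A (Fin n → F) := by
    intro hv
    rw [hfin] at hv
    refine h fun r => ?_
    rw [lift_standardPolynomial]
    refine Subtype.ext ((Matrix.toLin' (R := F)).injective (LinearMap.ext fun v => ?_))
    rw [← hsmul, hv]
    simp
  obtain ⟨b, g, hg, hb⟩ := exists_basis_blockTriangular (F := F) (A := A) hfin hnd.le_total
  obtain ⟨c, hc⟩ := exists_composition_index_lt_iff g hg
  let τ : Matrix (Fin n) (Fin n) F ≃ₐ[F] Matrix (Fin n) (Fin n) F :=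
    (Matrix.toLinAlgEquiv' (R := F) (n := Fin n)).trans (LinearMap.toMatrixAlgEquiv b)
  have hτ : ∀ M, τ M = LinearMap.toMatrix b b (Matrix.toLin' M) := fun _ => rfl
  refine ⟨c, τ, ?_⟩
  have hmem : ∀ M, M ∈ fullBlockUpperTriangular F c ↔ M.BlockTriangular g := by
    intro M
    change (∀ i j, c.index j < c.index i → M i j = 0) ↔ ∀ i j, g j < g i → M i j = 0
    simp_rw [hc]
  ext M
  rw [hmem, Subalgebra.mem_map]
  constructor
  · rintro ⟨a, ha, rfl⟩
    change (τ a).BlockTriangular g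
    rw [hτ, ← hb]
    exact fun q v hv => q.smul_mem (⟨a, ha⟩ : A) hv
  · intro hM
    have h1 : LinearMap.toMatrix b b (Matrix.toLin' (τ.symm M)) = M := by
      rw [← hτ, AlgEquiv.apply_symm_apply]
    rw [← h1, ← hb] at hM
    obtain ⟨a, ha⟩ := IsNondegenerate.exists_smul_of_forall_mem n _ hfin hnd _ hM
    have h2 : τ.symm M = a.1 := Matrix.toLin'.injective (LinearMap.ext ha)
    exact ⟨a, a.2, by rw [← h2]; exact τ.apply_symm_apply M⟩

theorem mainTheorem1 {F : Type*} [Field F] {n : ℕ} (hn : 0 < n)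
    (A : Subalgebra F (Matrix (Fin n) (Fin n) F)) :
    (¬ SatisfiesPolynomial A (standardPolynomial F (2 * n - 2)) →
      ∃ c : Composition n, EquivalentSubalgebras A (fullBlockUpperTriangular F c)) ∧
    List.TFAE [
      ¬ SatisfiesPolynomial A (standardPolynomial F (2 * n - 2)),
      ∃ c : Composition n, EquivalentSubalgebras A (fullBlockUpperTriangular F c),
      ∃ c : Composition n, Nonempty (A ≃ₐ[F] fullBlockUpperTriangular F c),
      ∀ f : FreeAlgebra F ℕ, f ≠ 0 → noncommDegree f < 2 * n → ¬ SatisfiesPolynomial A f] := by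
  refine ⟨exists_equivalentSubalgebras A, ?_⟩
  tfae_have 1 → 2 := exists_equivalentSubalgebras A
  tfae_have 2 → 3 := fun ⟨c, hc⟩ => ⟨c, hc.nonempty_algEquiv⟩
  tfae_have 3 → 4 := fun ⟨c, ⟨e⟩⟩ f hf hd hs =>
    not_satisfiesPolynomial_fullBlockUpperTriangular hn c hf hd (hs.of_algEquiv e)
  tfae_have 4 → 1 := fun h => h _ (standardPolynomial_ne_zero _)
    ((noncommDegree_standardPolynomial_le _).trans_lt (by omega))
  tfae_finish
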